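/- Let $\mathcal H\neq 0$ be a complex Hilbert space and let $H_0\ge I$ be a self-adjoint operator on $\mathcal H$ with domain $\mathcal D(H_0)$ and inverse $R_0=H_0^{-1}$. Suppose that $e^{-H_0}\in\mathcal C_{\beta_0}$ for some $0<\beta_0<1$, where $\mathcal C_p$ denotes the set of compact operators $A$ such that $|A|^p$ is of trace class. For an operator $A$, an $\omega$-direction of $A$ is a symmetric operator $Y:\mathcal D(A)\to\mathcal H$ that is $A$-bounded. The $\omega$-directions of $H_0$ form a real normed space with norm $\|Y\|_\omega:=\|R_0Y\|$, the operator norm of the bounded extension of $R_0Y$. Let $X$ be an $\omega$-direction of $H_0$ with $\|X\|_\omega<1-\beta_0$. Put $H_X=H_0+X$ on $\mathcal D(H_0)$, $Z_X={\rm Tr}\,e^{-H_X}$, $\rho_X=Z_X^{-1}e^{-H_X}$ and $\psi_X=\log Z_X$. Then the following hold. 1. $e^{-H_X}$ is of trace class and $Z_X>0$. 2. For all $\omega$-directions $Y,Z$ of $H_X$ the BKM metric $$g_X(Y,Z)=\int_0^1{\rm Tr}\left(\rho_X^{\alpha}Y\rho_X^{1-\alpha}Z\right)d\alpha$$ is finite: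 for every $\alpha\in(0,1)$ the operator $\rho_X^\alpha Y\rho_X^{1-\alpha}Z$ is densely defined and has a trace-class extension, and the trace of this extension is an integrable function of $\alpha$ on $(0,1)$. 3. For every $\omega$-direction $Y$ of $H_X$ the operator $\rho_XY$ has a trace-class extension. Write $\rho_X.Y:={\rm Tr}(\rho_XY)$ for the trace of this extension. 4. The map $V\mapsto\psi_V=\log{\rm Tr}\,e^{-(H_0+V)}$, on the $\omega$-directions of $H_0$ with the norm $\|\cdot\|_\omega$, is Fréchet differentiable at $V=X$, and its derivative is the bounded real-linear functional $Y\mapsto-\rho_X.Y$. In particular $\rho_X.Y$ is real. 5. Let $c$ be any real number such that $H_X+c\ge mI$ for some $m>0$ (for instance such that $H_X+c\ge I$), and put $R_X=(H_X+c)^{-1}$. Then there is a constant $C$, which does not depend on $Y$, such that $$|\rho_X.Y|\le C\,\|R_XY\|\qquad\text{for all }\omega\text{-directions }Y\text{ of }H_X,$$ so that the derivative is continuous in the $\omega$-norm. -/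

import Mathlib

open Topology

noncomputable section

namespace BKM

variable {E : Type*} [NormedAddCommGroup E] [InnerProductSpace ℂ E]

/-! ### Unbounded operators -/

/-- The product `A B` of two partially defined operators, on its natural domain
`{x ∈ D(B) | B x ∈ D(A)}`. -/
def opComp (A B : E →ₗ.[ℂ] E) : E →ₗ.[ℂ] E :=
  A.comp (B.domRestrict ((A.domain.comap B.toFun).map B.domain.subtype)) (by
    intro x
    obtain ⟨y, hy, hyx⟩ := (Submodule.mem_inf.1 x.2).1
    have h : B.domRestrict ((A.domain.comap B.toFun).map B.domain.subtype) x = B y :=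
      LinearPMap.domRestrict_apply hyx.symm
    rw [h]
    exact hy)

/-- A bounded operator, viewed as a partially defined operator with domain the whole space. -/
def ofBdd (T : E →L[ℂ] E) : E →ₗ.[ℂ] E := (T : E →ₗ[ℂ] E).toPMap ⊤

open scoped Classical in
/-- The bounded everywhere defined extension of `A`. It is unique when `A` is densely defined;
the value is `0` if there is none. -/
def bddExt (A : E →ₗ.[ℂ] E) : E →L[ℂ] E :=
  if h : ∃ T : E →L[ℂ] E, ∀ x : A.domain, T x = A x then h.choose else 0

/-- The bounded inverse `A⁻¹` of a bijective operator `A : D(A) → E`. -/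
def bddInv (A : E →ₗ.[ℂ] E) : E →L[ℂ] E := bddExt A.inverse

/-- The operator `A + V` on `D(A)`, for `V` defined on `D(A)`. -/
def perturb (A : E →ₗ.[ℂ] E) (V : A.domain →ₗ[ℂ] E) : E →ₗ.[ℂ] E := ⟨A.domain, A.toFun + V⟩

/-- The operator `A + c I` on `D(A)`. -/
def addConst (A : E →ₗ.[ℂ] E) (c : ℝ) : E →ₗ.[ℂ] E := perturb A ((c : ℂ) • A.domain.subtype)

/-- `A ≥ m I` in the sense of quadratic forms. -/
def LowerBound (m : ℝ) (A : E →ₗ.[ℂ] E) : Prop :=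
  ∀ x : A.domain, m * ‖(x : E)‖ ^ 2 ≤ (inner ℂ (x : E) (A x)).re

/-- The real vector space of `ω`-directions of `A`: the symmetric operators `Y : D(A) → E` that
are `A`-bounded. -/
def omegaDirections (A : E →ₗ.[ℂ] E) : Submodule ℝ (A.domain →ₗ[ℂ] E) where
  carrier := {Y | (∀ x y : A.domain, inner ℂ (Y x) (y : E) = inner ℂ (x : E) (Y y)) ∧
    ∃ a b : ℝ, ∀ x : A.domain, ‖Y x‖ ≤ a * ‖A x‖ + b * ‖(x : E)‖}
  zero_mem' := ⟨by simp, 0, 0, by simp⟩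
  add_mem' := by
    rintro Y Z ⟨hY, a, b, hab⟩ ⟨hZ, a', b', hab'⟩
    refine ⟨fun x y => ?_, a + a', b + b', fun x => ?_⟩
    · simp only [LinearMap.add_apply, inner_add_left, inner_add_right, hY x y, hZ x y]
    · have h1 := norm_add_le (Y x) (Z x)
      have h2 := hab x
      have h3 := hab' x
      simp only [LinearMap.add_apply]
      nlinarith
  smul_mem' := by
    rintro t Y ⟨hY, a, b, hab⟩
    refine ⟨fun x y => ?_, |t| * a, |t| * b, fun x => ?_⟩
    · have h1 : inner ℂ (t • Y x) (y : E) = (t : ℂ) * inner ℂ (Y x) (y : E) := by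
        rw [← Complex.coe_smul, inner_smul_left]; simp
      have h2 : inner ℂ (x : E) (t • Y y) = (t : ℂ) * inner ℂ (x : E) (Y y) := by
        rw [← Complex.coe_smul, inner_smul_right]
      simp only [LinearMap.smul_apply]
      rw [h1, h2, hY]
    · simp only [LinearMap.smul_apply, norm_smul, Real.norm_eq_abs]
      have h := mul_le_mul_of_nonneg_left (hab x) (abs_nonneg t)
      linarith

/-- An element of `omegaDirections A` as a partially defined operator with domain `D(A)`. -/
def toOp {A : E →ₗ.[ℂ] E} (Y : omegaDirections A) : E →ₗ.[ℂ] E := ⟨A.domain, Y.1⟩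

/-- The `ω`-size `‖R Y‖` of a partially defined operator `Y` relative to a bounded operator `R`:
the norm of the bounded extension of `R Y`. -/
def omegaSize (R : E →L[ℂ] E) (Y : E →ₗ.[ℂ] E) : ℝ := ‖bddExt (opComp (ofBdd R) Y)‖

lemma mem_opComp_ofBdd (R : E →L[ℂ] E) (Y : E →ₗ.[ℂ] E) (x : E) :
    x ∈ (opComp (ofBdd R) Y).domain ↔ x ∈ Y.domain := by
  constructor
  · exact fun h => (Submodule.mem_inf.1 h).2
  · exact fun h => Submodule.mem_inf.2 ⟨⟨⟨x, h⟩, Submodule.mem_top, rfl⟩, h⟩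

lemma opComp_ofBdd_apply (R : E →L[ℂ] E) (Y : E →ₗ.[ℂ] E)
    (x : (opComp (ofBdd R) Y).domain) :
    opComp (ofBdd R) Y x = R (Y ⟨x, (mem_opComp_ofBdd R Y x).1 x.2⟩) := rfl

lemma bddExt_apply (A : E →ₗ.[ℂ] E) (h : ∃ T : E →L[ℂ] E, ∀ x : A.domain, T x = A x)
    (x : A.domain) : bddExt A x = A x := by
  rw [bddExt, dif_pos h]
  exact h.choose_spec x

/-! ### Trace class and Schatten class operators -/

section Trace

variable [CompleteSpace E]

variable (E) in
/-- The index set of a chosen Hilbert basis of `E`. -/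
def basisIndex : Set E := (exists_hilbertBasis ℂ E).choose

variable (E) in
/-- A chosen Hilbert basis of `E`. Neither the trace class nor the trace depend on the choice. -/
def basis : HilbertBasis (basisIndex E) ℂ E := (exists_hilbertBasis ℂ E).choose_spec.choose

/-- `T` is of trace class: `∑ i, ⟪e i, |T| e i⟫ < ∞`. -/
def IsTraceClass (T : E →L[ℂ] E) : Prop :=
  Summable fun i => (inner ℂ (basis E i) (CFC.abs T (basis E i))).re

/-- The trace `∑ i, ⟪e i, T e i⟫` of a trace class operator. -/
def opTrace (T : E →L[ℂ] E) : ℂ := ∑' i, inner ℂ (basis E i) (T (basis E i))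

/-- The class `𝒞_p`: the compact operators `T` such that `|T| ^ p` is of trace class. -/
def IsSchatten (p : ℝ) (T : E →L[ℂ] E) : Prop :=
  IsCompactOperator T ∧ IsTraceClass (CFC.abs T ^ p)

/-- The densely defined operator `A` has a (necessarily unique) extension to a bounded operator on
`E` that is of trace class. -/
def HasTraceClassExt (A : E →ₗ.[ℂ] E) : Prop :=
  Dense (A.domain : Set E) ∧
    ∃ T : E →L[ℂ] E, (∀ x : A.domain, T x = A x) ∧ IsTraceClass T

/-- The trace of the bounded extension of `A`. -/
def traceExt (A : E →ₗ.[ℂ] E) : ℂ := opTrace (bddExt A)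

/-! ### States -/

/-- `e^{-A}` for a self-adjoint `A ≥ m I` with `m > 0`, as the function `r ↦ e^{-1/r}`
(with value `0` at `r ≤ 0`) of the bounded injective operator `A⁻¹ ≥ 0`. -/
def expNeg (A : E →ₗ.[ℂ] E) : E →L[ℂ] E := cfc expNegInvGlue (bddInv A)

/-- The partition function `Z = Tr e^{-A}`. -/
def partition (A : E →ₗ.[ℂ] E) : ℝ := (opTrace (expNeg A)).re

/-- The free energy `ψ = log Z`. -/
def freeEnergy (A : E →ₗ.[ℂ] E) : ℝ := Real.log (partition A)

/-- The density operator `ρ = Z⁻¹ e^{-A}`. -/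
def state (A : E →ₗ.[ℂ] E) : E →L[ℂ] E := (partition A)⁻¹ • expNeg A

/-- The operator `ρ Y`. -/
def stateMul (ρ : E →L[ℂ] E) (Y : E →ₗ.[ℂ] E) : E →ₗ.[ℂ] E := opComp (ofBdd ρ) Y

/-- The mean `ρ.Y = Tr (ρ Y)`. -/
def mean (ρ : E →L[ℂ] E) (Y : E →ₗ.[ℂ] E) : ℂ := traceExt (stateMul ρ Y)

/-- The operator `ρ ^ α Y ρ ^ (1 - α) Z`. -/
def bkmOp (ρ : E →L[ℂ] E) (Y Z : E →ₗ.[ℂ] E) (α : ℝ) : E →ₗ.[ℂ] E :=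
  opComp (ofBdd (ρ ^ α)) (opComp Y (opComp (ofBdd (ρ ^ (1 - α))) Z))

/-- The integrand `Tr (ρ ^ α Y ρ ^ (1 - α) Z)` of the BKM metric. -/
def bkmIntegrand (ρ : E →L[ℂ] E) (Y Z : E →ₗ.[ℂ] E) (α : ℝ) : ℂ := traceExt (bkmOp ρ Y Z α)

/-- The BKM metric `∫₀¹ Tr (ρ ^ α Y ρ ^ (1 - α) Z) dα` is finite: the operator under the trace has
a trace class extension for all `0 < α < 1`, and its trace is an integrable function of `α`. -/
def BKMFinite (ρ : E →L[ℂ] E) (Y Z : E →ₗ.[ℂ] E) : Prop :=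
  (∀ α ∈ Set.Ioo (0 : ℝ) 1, HasTraceClassExt (bkmOp ρ Y Z α)) ∧
    IntervalIntegrable (bkmIntegrand ρ Y Z) MeasureTheory.volume 0 1

end Trace

/-! ### Hamiltonians and the `ω`-norm -/

section Hamiltonian

variable [CompleteSpace E]

variable (E) in
/-- A self-adjoint (in particular densely defined) operator `H ≥ I`. -/
structure Hamiltonian where
  op : E →ₗ.[ℂ] E
  selfAdjoint : IsSelfAdjoint op
  one_le : LowerBound 1 op

namespace Hamiltonian

variable (H : Hamiltonian E)

lemma dense : Dense (H.op.domain : Set E) := H.selfAdjoint.dense_domain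

lemma symm (x y : H.op.domain) : inner ℂ (H.op x) (y : E) = inner ℂ (x : E) (H.op y) := by
  have h := LinearPMap.adjoint_isFormalAdjoint H.dense
  rw [LinearPMap.isSelfAdjoint_def.1 H.selfAdjoint] at h
  exact h x y

lemma norm_le (x : H.op.domain) : ‖(x : E)‖ ≤ ‖H.op x‖ := by
  have h1 := H.one_le x
  have h2 : (inner ℂ (x : E) (H.op x)).re ≤ ‖(x : E)‖ * ‖H.op x‖ :=
    (Complex.re_le_norm _).trans (norm_inner_le_norm _ _)
  by_contra! h
  nlinarith [norm_nonneg (x : E), norm_nonneg (H.op x)]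

lemma ker_eq_bot : LinearMap.ker H.op.toFun = ⊥ := by
  rw [LinearMap.ker_eq_bot']
  intro x hx
  have h := H.norm_le x
  have h0 : ‖H.op x‖ = 0 := by
    have : H.op x = 0 := hx
    simp [this]
  rw [h0] at h
  exact Subtype.ext (norm_le_zero_iff.1 h)

lemma isClosed_range : IsClosed (LinearMap.range H.op.toFun : Set E) := by
  refine IsSeqClosed.isClosed fun u y hu hy => ?_
  choose x hx using hu
  have hx' : ∀ n, H.op (x n) = u n := hx
  have hc : CauchySeq fun n => (x n : E) := by
    rw [Metric.cauchySeq_iff']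
    intro ε hε
    obtain ⟨N, hN⟩ := Metric.cauchySeq_iff'.1 hy.cauchySeq ε hε
    refine ⟨N, fun n hn => lt_of_le_of_lt ?_ (hN n hn)⟩
    rw [dist_eq_norm, dist_eq_norm, ← hx', ← hx', ← LinearPMap.map_sub]
    exact H.norm_le (x n - x N)
  obtain ⟨z, hz⟩ := cauchySeq_tendsto_of_complete hc
  have key : ∀ w : H.op.domain, inner ℂ y (w : E) = inner ℂ z (H.op w) := fun w => by
    refine tendsto_nhds_unique (f := fun n => inner ℂ (u n) (w : E)) (l := Filter.atTop)
      (hy.inner tendsto_const_nhds) ?_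
    have : (fun n => inner ℂ (u n) (w : E)) = fun n => inner ℂ (x n : E) (H.op w) := by
      funext n
      rw [← hx', H.symm]
    rw [this]
    exact hz.inner tendsto_const_nhds
  have hmem : z ∈ H.op.adjoint.domain := LinearPMap.mem_adjoint_domain_of_exists z ⟨y, key⟩
  have happ : H.op.adjoint ⟨z, hmem⟩ = y := LinearPMap.adjoint_apply_eq H.dense _ key
  have hgr : (z, y) ∈ H.op.adjoint.graph := by
    rw [LinearPMap.mem_graph_iff]
    exact ⟨⟨z, hmem⟩, rfl, happ⟩
  rw [LinearPMap.isSelfAdjoint_def.1 H.selfAdjoint, LinearPMap.mem_graph_iff] at hgr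
  obtain ⟨v, -, hv⟩ := hgr
  exact ⟨v, hv⟩

lemma range_eq_top : LinearMap.range H.op.toFun = ⊤ := by
  have hcl := H.isClosed_range
  have : CompleteSpace (LinearMap.range H.op.toFun) := hcl.completeSpace_coe
  rw [← Submodule.orthogonal_eq_bot_iff, Submodule.eq_bot_iff]
  intro z hz
  have key : ∀ w : H.op.domain, inner ℂ (0 : E) (w : E) = inner ℂ z (H.op w) := fun w => by
    have hw : H.op w ∈ LinearMap.range H.op.toFun := LinearMap.mem_range_self H.op.toFun w
    rw [inner_zero_left, Submodule.inner_left_of_mem_orthogonal hw hz]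
  have hmem : z ∈ H.op.adjoint.domain := LinearPMap.mem_adjoint_domain_of_exists z ⟨0, key⟩
  have happ : H.op.adjoint ⟨z, hmem⟩ = 0 := LinearPMap.adjoint_apply_eq H.dense _ key
  have hgr : (z, (0 : E)) ∈ H.op.adjoint.graph := by
    rw [LinearPMap.mem_graph_iff]
    exact ⟨⟨z, hmem⟩, rfl, happ⟩
  rw [LinearPMap.isSelfAdjoint_def.1 H.selfAdjoint, LinearPMap.mem_graph_iff] at hgr
  obtain ⟨v, hv, hv0⟩ := hgr
  have h := H.norm_le v
  rw [hv0, norm_zero] at h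
  rw [← norm_le_zero_iff]
  simpa [hv] using h

/-- The bounded operator `R = H⁻¹`. -/
def R : E →L[ℂ] E := bddInv H.op

lemma exists_pre (y : E) : ∃ x : H.op.domain, H.op x = y := by
  have h : y ∈ LinearMap.range H.op.toFun := by rw [H.range_eq_top]; trivial
  exact h

lemma R_op (x : H.op.domain) : H.R (H.op x) = x := by
  have hmem : ∀ y, y ∈ H.op.inverse.domain := fun y => by
    rw [LinearPMap.inverse_domain, H.range_eq_top]; trivial
  let S : E →ₗ[ℂ] E := H.op.inverse.toFun.comp (LinearMap.id.codRestrict _ hmem)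
  have hS : ∀ z : H.op.domain, S (H.op z) = z := fun z =>
    LinearPMap.inverse_apply_eq H.ker_eq_bot (y := ⟨H.op z, hmem _⟩) rfl
  have hb : ∀ y, ‖S y‖ ≤ 1 * ‖y‖ := fun y => by
    obtain ⟨z, rfl⟩ := H.exists_pre y
    rw [hS, one_mul]
    exact H.norm_le z
  have h := bddExt_apply H.op.inverse ⟨S.mkContinuous 1 hb, fun _ => rfl⟩ ⟨H.op x, hmem _⟩
  exact h.trans (hS x)

lemma R_symm (x y : E) : inner ℂ (H.R x) y = inner ℂ x (H.R y) := by
  obtain ⟨u, rfl⟩ := H.exists_pre x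
  obtain ⟨v, rfl⟩ := H.exists_pre y
  rw [R_op, R_op, H.symm]

lemma R_injective : Function.Injective H.R := by
  intro x y h
  obtain ⟨u, rfl⟩ := H.exists_pre x
  obtain ⟨v, rfl⟩ := H.exists_pre y
  rw [R_op, R_op] at h
  rw [Subtype.ext h]

lemma exists_ext (Y : omegaDirections H.op) :
    ∃ T : E →L[ℂ] E, ∀ x : H.op.domain, T x = H.R (Y.1 x) := by
  obtain ⟨hs, a, b, hab⟩ := Y.2
  have hR : ∀ y, H.R y ∈ H.op.domain := fun y => by
    obtain ⟨z, rfl⟩ := H.exists_pre y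
    rw [R_op]
    exact z.2
  let S : E →ₗ[ℂ] E := Y.1.comp ((H.R : E →ₗ[ℂ] E).codRestrict _ hR)
  have hS : ∀ z : H.op.domain, S (H.op z) = Y.1 z := fun z =>
    congrArg Y.1 (Subtype.ext (H.R_op z))
  have hb : ∀ y, ‖S y‖ ≤ (|a| + |b|) * ‖y‖ := fun y => by
    obtain ⟨z, rfl⟩ := H.exists_pre y
    rw [hS]
    refine (hab z).trans ?_
    have h1 := H.norm_le z
    have h2 : a * ‖H.op z‖ ≤ |a| * ‖H.op z‖ :=
      mul_le_mul_of_nonneg_right (le_abs_self a) (norm_nonneg _)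
    have h3 : b * ‖(z : E)‖ ≤ |b| * ‖H.op z‖ :=
      mul_le_mul (le_abs_self b) h1 (norm_nonneg _) (abs_nonneg _)
    linarith
  refine ⟨(S.mkContinuous _ hb).adjoint, fun x => ?_⟩
  refine ext_inner_right ℂ fun y => ?_
  rw [ContinuousLinearMap.adjoint_inner_left, R_symm]
  exact (hs x ⟨H.R y, hR y⟩).symm

lemma bddExt_R_apply (Y : omegaDirections H.op) (x : H.op.domain) :
    bddExt (opComp (ofBdd H.R) (toOp Y)) x = H.R (Y.1 x) := by
  obtain ⟨T, hT⟩ := H.exists_ext Y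
  exact bddExt_apply (opComp (ofBdd H.R) (toOp Y))
    ⟨T, fun z => hT ⟨z, (mem_opComp_ofBdd H.R (toOp Y) z).1 z.2⟩⟩
    ⟨x, (mem_opComp_ofBdd H.R (toOp Y) x).2 x.2⟩

/-- The real linear map `Y ↦ R Y` (bounded extension) on the `ω`-directions. -/
def omegaMap : omegaDirections H.op →ₗ[ℝ] (E →L[ℂ] E) where
  toFun Y := bddExt (opComp (ofBdd H.R) (toOp Y))
  map_add' Y Z := by
    refine ContinuousLinearMap.ext fun v => ?_
    refine congrFun (Continuous.ext_on H.dense (ContinuousLinearMap.continuous _)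
      (ContinuousLinearMap.continuous _) fun x hx => ?_) v
    have h := H.bddExt_R_apply (Y + Z) ⟨x, hx⟩
    have h1 := H.bddExt_R_apply Y ⟨x, hx⟩
    have h2 := H.bddExt_R_apply Z ⟨x, hx⟩
    simp only [add_apply] at *
    rw [h, h1, h2]
    simp
  map_smul' t Y := by
    refine ContinuousLinearMap.ext fun v => ?_
    refine congrFun (Continuous.ext_on H.dense (ContinuousLinearMap.continuous _)
      (ContinuousLinearMap.continuous _) fun x hx => ?_) v
    have h := H.bddExt_R_apply (t • Y) ⟨x, hx⟩
    have h1 := H.bddExt_R_apply Y ⟨x, hx⟩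
    simp only [smul_apply, RingHom.id_apply] at *
    rw [h, h1, ← Complex.coe_smul, ← map_smul]
    simp

lemma omegaMap_injective : Function.Injective H.omegaMap := by
  rw [injective_iff_map_eq_zero]
  intro Y hY
  refine Subtype.ext (LinearMap.ext fun x => H.R_injective ?_)
  rw [← H.bddExt_R_apply Y x]
  change H.omegaMap Y x = _
  rw [hY]
  simp

/-- The `ω`-norm `‖Y‖_ω = ‖R Y‖` on the space of `ω`-directions of `H`. -/
instance instNormedAddCommGroup : NormedAddCommGroup (omegaDirections H.op) :=
  NormedAddCommGroup.induced _ _ H.omegaMap H.omegaMap_injective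

instance instNormedSpace : NormedSpace ℝ (omegaDirections H.op) :=
  NormedSpace.induced ℝ _ _ H.omegaMap

lemma norm_eq (Y : omegaDirections H.op) : ‖Y‖ = omegaSize H.R (toOp Y) := rfl

end Hamiltonian

end Hamiltonian

end BKM

end

/-! Everything is reduced to sums over eigenvalues. Since $e^{-H_0}$ is compact and $R_0$ is a
continuous function of it, $H_0$ has an eigenbasis with eigenvalues $k_j$, $\sum_j
e^{-\beta_0k_j}<\infty$, and $R_0$ is compact (`Hamiltonian.exists_isDiagonalized`). Because
$H_X=(1+XR_0)H_0$ with $\|XR_0\|=\|R_0X\|<1$, a Neumann series gives a compact symmetric inverse of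
$H_X$, hence an eigenbasis $e_i$ with eigenvalues $l_i>0$ (`exists_isDiagonalized_perturb`).

The key estimate is $(1-\|X\|)\|H_0e_i\|\le l_i$. With Jensen's inequality for the spectral measure
of $e_i$ under $H_0$ it gives $\sum_ie^{-sl_i}\le\sum_je^{-\beta_0k_j}$ for $s=\beta_0/(1-\|X\|)<1$
(`summable_exp_perturb`). The margin $1-s$ absorbs powers of $l_i$, so all sums
$\sum_il_i^ce^{-l_i}$ with $c\ge0$ converge.

An $\omega$-direction of $A=H_X$ is $Y=BA$ with $B$ bounded, and $B^*$ extends $A^{-1}Y$. Thus $\rho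
Y=(\rho A)B^*$ is trace class, and $\rho^\alpha Y\rho^{1-\alpha}Z$ factors as $\rho^\alpha
B_Y(A\rho^{1-\alpha}A)B_Z^*$. Its trace class property follows from a weighted Hilbert–Schmidt
estimate and duality (`isTraceClass_of_matrix`); the trace is a double series dominated uniformly in
$\alpha$ (`bkmFinite`). For the resolvent bound, $\langle e_i,Ye_i\rangle=(l_i+c)\langle
e_i,R_XYe_i\rangle$.

For the derivative, let $f_j$, $m_j$ diagonalize $H_{X+W}$. Since $\langle
f_j,We_i\rangle=(m_j-l_i)\langle f_j,e_i\rangle$, the first order remainder of the partition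
function is an average of scalar Taylor remainders of $e^{-x}$ with weights $|\langle
f_j,e_i\rangle|^2$. It is at most
$\sum_je^{-m_j}\|Wf_j\|^2+\sum_ie^{-l_i}\|We_i\|^2=O(\|W\|_\omega^2)$ (`abs_sum_exp_sub_le`,
`abs_partition_sub_le`), with no commutation of $X$ and $W$ needed. -/

namespace BKM

/-! ### Hilbert–Schmidt sums, the trace and criteria for trace class -/

section HilbertSchmidt

variable {E : Type*} [NormedAddCommGroup E] [InnerProductSpace ℂ E]
variable {ι κ : Type*}

lemma hasSum_norm_inner_sq (b : HilbertBasis ι ℂ E) (x : E) :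
    HasSum (fun i => ‖inner ℂ (b i) x‖ ^ 2) (‖x‖ ^ 2) := by
  have h := b.hasSum_inner_mul_inner x x
  have h2 : (fun i => inner ℂ x (b i) * inner ℂ (b i) x) =
      fun i => ((‖inner ℂ (b i) x‖ ^ 2 : ℝ) : ℂ) := by
    funext i
    rw [← inner_conj_symm, Complex.conj_mul']
    push_cast
    rfl
  rw [h2, inner_self_eq_norm_sq_to_K] at h
  have h3 : HasSum (fun i => ((‖inner ℂ (b i) x‖ ^ 2 : ℝ) : ℂ)) ((‖x‖ ^ 2 : ℝ) : ℂ) := by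
    convert! h using 1
    push_cast
    rfl
  exact Complex.hasSum_ofReal.1 h3

lemma ext_hilbertBasis (b : HilbertBasis ι ℂ E) {x y : E}
    (h : ∀ i, inner ℂ (b i) x = inner ℂ (b i) y) : x = y := by
  have h1 := hasSum_norm_inner_sq b (x - y)
  have h2 : (fun i => ‖inner ℂ (b i) (x - y)‖ ^ 2) = fun _ => (0 : ℝ) := by
    funext i
    rw [inner_sub_right, h i]
    simp
  rw [h2] at h1
  have h3 := h1.unique hasSum_zero
  have h4 : ‖x - y‖ = 0 := by simpa using h3
  exact sub_eq_zero.1 (norm_eq_zero.1 h4)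

lemma norm_hilbertBasis (b : HilbertBasis ι ℂ E) (i : ι) : ‖b i‖ = 1 := b.orthonormal.1 i

lemma inner_hilbertBasis [DecidableEq ι] (b : HilbertBasis ι ℂ E) (i j : ι) :
    inner ℂ (b i) (b j) = if i = j then 1 else 0 :=
  orthonormal_iff_ite.1 b.orthonormal i j

/-- Parseval in the second index. The weighted form is the device behind every later interchange of
sums over two bases. -/
lemma summable_prod_norm_inner_sq (b' : HilbertBasis κ ℂ E) {w : ι → ℝ} (hw : ∀ i, 0 ≤ w i)
    {v : ι → E} (h : Summable fun i => w i * ‖v i‖ ^ 2) :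
    Summable fun p : ι × κ => w p.1 * ‖inner ℂ (b' p.2) (v p.1)‖ ^ 2 := by
  have h0 : 0 ≤ fun p : ι × κ => w p.1 * ‖inner ℂ (b' p.2) (v p.1)‖ ^ 2 := fun p => by
    have := hw p.1
    dsimp only [Pi.zero_apply]
    positivity
  refine (summable_prod_of_nonneg h0).2
    ⟨fun i => (hasSum_norm_inner_sq b' (v i)).summable.mul_left (w i), h.congr fun i => ?_⟩
  exact ((hasSum_norm_inner_sq b' (v i)).mul_left (w i)).tsum_eq.symm

lemma hasSum_prod_norm_inner_sq (b' : HilbertBasis κ ℂ E) {w : ι → ℝ} (hw : ∀ i, 0 ≤ w i)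
    {v : ι → E} {s : ℝ} (h : HasSum (fun i => w i * ‖v i‖ ^ 2) s) :
    HasSum (fun p : ι × κ => w p.1 * ‖inner ℂ (b' p.2) (v p.1)‖ ^ 2) s := by
  have h1 := (summable_prod_norm_inner_sq b' hw h.summable).hasSum
  have h2 := h1.prod_fiberwise fun i => (hasSum_norm_inner_sq b' (v i)).mul_left (w i)
  rwa [← h2.unique h]

variable [CompleteSpace E]

lemma summable_adjoint (b : HilbertBasis ι ℂ E) (b' : HilbertBasis κ ℂ E) {A : E →L[ℂ] E}
    (h : Summable fun i => ‖A (b i)‖ ^ 2) : Summable fun k => ‖A.adjoint (b' k)‖ ^ 2 := by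
  have h1 := summable_prod_norm_inner_sq b' (w := fun _ => 1) (fun _ => zero_le_one)
    (v := fun i => A (b i)) (by simpa using h)
  have h2 := h1.prod_symm
  rw [summable_prod_of_nonneg (fun p => by positivity)] at h2
  refine h2.2.congr fun k => ?_
  rw [← (hasSum_norm_inner_sq b (A.adjoint (b' k))).tsum_eq]
  refine tsum_congr fun i => ?_
  rw [ContinuousLinearMap.adjoint_inner_right, ← inner_conj_symm, RCLike.norm_conj, one_mul]
  rfl

/-- Both sides are iterated sums of $\langle Ab_i,b'_k\rangle\langle b'_k,Bb_i\rangle$, which is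
absolutely summable by the Hilbert–Schmidt hypotheses. -/
lemma hasSum_adjoint_comm (b : HilbertBasis ι ℂ E) (b' : HilbertBasis κ ℂ E) {A B : E →L[ℂ] E}
    (hA : Summable fun i => ‖A (b i)‖ ^ 2) (hB : Summable fun i => ‖B (b i)‖ ^ 2) :
    HasSum (fun k => inner ℂ (B.adjoint (b' k)) (A.adjoint (b' k)))
      (∑' i, inner ℂ (A (b i)) (B (b i))) := by
  have h1 := summable_prod_norm_inner_sq b' (w := fun _ => 1) (fun _ => zero_le_one)
    (v := fun i => A (b i)) (by simpa using hA)
  have h2 := summable_prod_norm_inner_sq b' (w := fun _ => 1) (fun _ => zero_le_one)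
    (v := fun i => B (b i)) (by simpa using hB)
  have hF : Summable fun p : ι × κ => inner ℂ (A (b p.1)) (b' p.2) * inner ℂ (b' p.2) (B (b p.1)) := by
    refine Summable.of_norm_bounded (h1.add h2) fun p => ?_
    rw [norm_mul, ← inner_conj_symm, RCLike.norm_conj]
    simp only [one_mul]
    nlinarith [sq_nonneg (‖inner ℂ (b' p.2) (A (b p.1))‖ - ‖inner ℂ (b' p.2) (B (b p.1))‖),
      sq_nonneg (‖inner ℂ (b' p.2) (A (b p.1))‖), sq_nonneg ‖inner ℂ (b' p.2) (B (b p.1))‖]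
  have h3 := hF.hasSum.prod_fiberwise fun i => b'.hasSum_inner_mul_inner (A (b i)) (B (b i))
  rw [h3.tsum_eq]
  refine ((Equiv.prodComm κ ι).hasSum_iff.2 hF.hasSum).prod_fiberwise fun k => ?_
  have h4 := b.hasSum_inner_mul_inner (B.adjoint (b' k)) (A.adjoint (b' k))
  refine h4.congr_fun fun i => ?_
  simp only [Function.comp, Equiv.prodComm_apply, Prod.swap]
  rw [ContinuousLinearMap.adjoint_inner_left, ContinuousLinearMap.adjoint_inner_right, mul_comm]

/-- Douglas factorization. -/
lemma exists_contraction {S T : E →L[ℂ] E} (h : ∀ x, ‖S x‖ ≤ ‖T x‖) :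
    ∃ W : E →L[ℂ] E, ‖W‖ ≤ 1 ∧ ∀ x, W (T x) = S x := by
  let K : Submodule ℂ E := (LinearMap.range (T : E →ₗ[ℂ] E)).topologicalClosure
  have hK : ∀ x, T x ∈ K := fun x => Submodule.le_topologicalClosure _ ⟨x, rfl⟩
  let e : E →ₗ[ℂ] K := (T : E →ₗ[ℂ] E).codRestrict K hK
  have hd : DenseRange e := by
    intro y
    rw [Metric.mem_closure_iff]
    intro ε hε
    obtain ⟨z, ⟨x, rfl⟩, hz⟩ := Metric.mem_closure_iff.1 y.2 ε hε
    exact ⟨e x, ⟨x, rfl⟩, hz⟩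
  have hn : ∀ x, ‖(S : E →ₗ[ℂ] E) x‖ ≤ 1 * ‖e x‖ := fun x => by
    rw [one_mul]; exact h x
  have : CompleteSpace K := (Submodule.isClosed_topologicalClosure _).completeSpace_coe
  refine ⟨((S : E →ₗ[ℂ] E).extendOfNorm e).comp K.orthogonalProjectionOnto, ?_, fun x => ?_⟩
  · refine (ContinuousLinearMap.opNorm_comp_le _ _).trans ?_
    exact mul_le_one₀ (LinearMap.opNorm_extendOfNorm_le hd zero_le_one hn) (norm_nonneg _)
      (Submodule.orthogonalProjectionOnto_norm_le K)
  · rw [ContinuousLinearMap.comp_apply]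
    have : K.orthogonalProjectionOnto (T x) = e x :=
      Submodule.orthogonalProjectionOnto_mem_subspace_eq_self (K := K) ⟨T x, hK x⟩
    rw [this, LinearMap.extendOfNorm_eq hd ⟨1, hn⟩]
    rfl

lemma inner_apply_of_isSelfAdjoint {S : E →L[ℂ] E} (hS : IsSelfAdjoint S) (x y : E) :
    inner ℂ (S x) y = inner ℂ x (S y) := by
  rw [← ContinuousLinearMap.adjoint_inner_right, hS.adjoint_eq]

lemma norm_abs_apply (T : E →L[ℂ] E) (x : E) : ‖CFC.abs T x‖ = ‖T x‖ := by
  have h : CFC.abs T * CFC.abs T = star T * T := CFC.abs_mul_abs T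
  have hs : IsSelfAdjoint (CFC.abs T) := (CFC.abs_nonneg T).isSelfAdjoint
  have h1 : inner ℂ (CFC.abs T x) (CFC.abs T x) = inner ℂ (T x) (T x) := by
    rw [inner_apply_of_isSelfAdjoint hs, ← mul_apply_eq_comp, h,
      mul_apply_eq_comp, ContinuousLinearMap.star_eq_adjoint,
      ContinuousLinearMap.adjoint_inner_right]
  rw [inner_self_eq_norm_sq_to_K, inner_self_eq_norm_sq_to_K] at h1
  have h2 : ‖CFC.abs T x‖ ^ 2 = ‖T x‖ ^ 2 := by exact_mod_cast h1
  exact (sq_eq_sq₀ (norm_nonneg _) (norm_nonneg _)).1 h2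

lemma inner_sqrt {P : E →L[ℂ] E} (hP : 0 ≤ P) (x : E) :
    inner ℂ x (P x) = ((‖CFC.sqrt P x‖ ^ 2 : ℝ) : ℂ) := by
  have hs : IsSelfAdjoint (CFC.sqrt P) := (CFC.sqrt_nonneg P).isSelfAdjoint
  conv_lhs => rw [← CFC.sqrt_mul_sqrt_self P hP]
  rw [mul_apply_eq_comp, ← inner_apply_of_isSelfAdjoint hs, inner_self_eq_norm_sq_to_K]
  push_cast
  rfl

/-- Independence of the trace from the basis: $T=(US)S$ with $S=|T|^{1/2}$ and $U$ a contraction,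
and both factors are Hilbert–Schmidt. -/
lemma IsTraceClass.hasSum {T : E →L[ℂ] E} (hT : IsTraceClass T) (e : HilbertBasis ι ℂ E) :
    HasSum (fun i => inner ℂ (e i) (T (e i))) (opTrace T) := by
  set b := basis E
  set S := CFC.sqrt (CFC.abs T) with hS_def
  have hs : IsSelfAdjoint S := (CFC.sqrt_nonneg _).isSelfAdjoint
  have hS : Summable fun i => ‖S (b i)‖ ^ 2 := by
    refine Summable.congr hT fun i => ?_
    rw [inner_sqrt (CFC.abs_nonneg T), Complex.ofReal_re]
  obtain ⟨U, hU, hUT⟩ := exists_contraction (S := T) (T := CFC.abs T)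
    fun x => (norm_abs_apply T x).ge
  have hUSS : ∀ x, U (S (S x)) = T x := fun x => by
    rw [← hUT, ← CFC.sqrt_mul_sqrt_self (CFC.abs T) (CFC.abs_nonneg T)]
    rfl
  have hB' : Summable fun i => ‖(U ∘L S) (b i)‖ ^ 2 := by
    refine Summable.of_nonneg_of_le (fun _ => by positivity) (fun i => ?_) hS
    refine pow_le_pow_left₀ (norm_nonneg _) ((U.le_opNorm _).trans ?_) 2
    exact mul_le_of_le_one_left (norm_nonneg _) hU
  have hA : Summable fun i => ‖(U ∘L S).adjoint (b i)‖ ^ 2 := summable_adjoint b b hB'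
  have key : ∀ x : E, inner ℂ ((U ∘L S).adjoint x) (S x) = inner ℂ x (T x) := fun x => by
    rw [ContinuousLinearMap.adjoint_inner_left, ContinuousLinearMap.comp_apply, hUSS]
  -- The first exchange passes from the chosen basis to `e` but reverses the two factors; a second
  -- exchange inside `e` restores their order.
  have h1 := hasSum_adjoint_comm b e hA hS
  simp only [ContinuousLinearMap.adjoint_adjoint] at h1
  have hAe := summable_adjoint b e hB'
  have hSe := summable_adjoint b e hS
  rw [hs.adjoint_eq] at hSe h1
  have h2 := hasSum_adjoint_comm e e hSe (summable_adjoint b e hA)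
  simp only [ContinuousLinearMap.adjoint_adjoint] at h2
  rw [hs.adjoint_eq, h1.tsum_eq] at h2
  simp only [key] at h2
  exact h2

/-- Duality: the trace norm is controlled by $\operatorname{Tr}(TQ)$ over contractions $Q$. This
avoids computing $|T|$ in applications. -/
lemma isTraceClass_of_bound (e : HilbertBasis ι ℂ E) (T : E →L[ℂ] E) (C : ℝ)
    (h : ∀ Q : E →L[ℂ] E, ‖Q‖ ≤ 1 → ∀ t,
      HasSum (fun i => inner ℂ (e i) (T (Q (e i)))) t → ‖t‖ ≤ C) : IsTraceClass T := by
  set b := basis E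
  obtain ⟨W, hW, hWT⟩ := exists_contraction (S := CFC.abs T) (T := T)
    fun x => (norm_abs_apply T x).le
  have hnn : ∀ x, 0 ≤ (inner ℂ x (CFC.abs T x)).re := fun x => by
    rw [inner_sqrt (CFC.abs_nonneg T), Complex.ofReal_re]
    positivity
  refine summable_of_sum_le (c := C) (fun i => hnn _) fun F => ?_
  -- With $WT=|T|$ and $P_F$ the projection onto the span of $b_k$, $k\in F$, the choice $Q=P_FW$
  -- gives $\operatorname{Tr}(TQ)=\sum_{k\in F}\langle b_k,|T|b_k\rangle$, a partial sum of the
  -- trace norm.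
  let Q : E →L[ℂ] E := (∑ k ∈ F, (innerSL ℂ (b k)).smulRight (b k)) ∘L W
  have hQx : ∀ x, Q x = ∑ k ∈ F, inner ℂ (b k) (W x) • b k := fun x => by
    simp [Q]
  have hQ : ‖Q‖ ≤ 1 := by
    refine ContinuousLinearMap.opNorm_le_bound _ zero_le_one fun x => ?_
    have h1 : ‖Q x‖ ^ 2 = ∑ k ∈ F, ‖inner ℂ (b k) (W x)‖ ^ 2 := by
      have h2 : inner ℂ (Q x) (Q x) = ∑ k ∈ F,
          (starRingEnd ℂ) (inner ℂ (b k) (W x)) * inner ℂ (b k) (W x) := by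
        rw [hQx]
        exact b.orthonormal.inner_sum _ _ F
      rw [inner_self_eq_norm_sq_to_K] at h2
      simp only [Complex.conj_mul'] at h2
      exact Complex.ofReal_injective (by push_cast; exact h2)
    have h3 : ‖Q x‖ ^ 2 ≤ ‖W x‖ ^ 2 := by
      rw [h1]
      exact sum_le_hasSum F (fun _ _ => by positivity) (hasSum_norm_inner_sq b (W x))
    have h4 : ‖Q x‖ ≤ ‖W x‖ := (sq_le_sq₀ (norm_nonneg _) (norm_nonneg _)).1 h3
    refine h4.trans ((W.le_opNorm x).trans ?_)
    exact mul_le_mul_of_nonneg_right hW (norm_nonneg _)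
  have hs : HasSum (fun i => inner ℂ (e i) (T (Q (e i))))
      (∑ k ∈ F, inner ℂ (b k) (W (T (b k)))) := by
    have h1 : HasSum (fun i => ∑ k ∈ F,
        inner ℂ (W.adjoint (b k)) (e i) * inner ℂ (e i) (T (b k)))
        (∑ k ∈ F, inner ℂ (W.adjoint (b k)) (T (b k))) :=
      hasSum_sum fun k _ => e.hasSum_inner_mul_inner _ _
    simp only [ContinuousLinearMap.adjoint_inner_left] at h1
    refine h1.congr_fun fun i => ?_
    rw [hQx, map_sum, inner_sum]
    refine Finset.sum_congr rfl fun k _ => ?_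
    rw [map_smul, inner_smul_right]
  have h5 := h Q hQ _ hs
  refine le_trans ?_ h5
  simp only [hWT]
  rw [← Complex.re_sum]
  exact Complex.re_le_norm _

lemma norm_inner_eq_adjoint {A : E →L[ℂ] E} (x y : E) :
    ‖inner ℂ x (A y)‖ = ‖inner ℂ y (A.adjoint x)‖ := by
  rw [ContinuousLinearMap.adjoint_inner_right, ← inner_conj_symm, RCLike.norm_conj]

/-- The hypothesis describes $T=UAVB$ with $U$, $V$ diagonal. Each term of $\operatorname{Tr}(TQ)$
is at most $(p_i+w_j)(|A_{ij}|^2+|(BQ)_{ji}|^2)$, and summing along rows or columns costs only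
$\|A\|^2$ or $\|BQ\|^2\le\|B\|^2$. It replaces Hölder's inequality for Schatten classes. -/
lemma isTraceClass_of_matrix (e : HilbertBasis ι ℂ E) {u v p w : ι → ℝ} (hu : ∀ i, 0 ≤ u i)
    (hv : ∀ i, 0 ≤ v i) (hp : Summable p) (hw : Summable w) (hp0 : ∀ i, 0 ≤ p i)
    (hw0 : ∀ i, 0 ≤ w i) (huv : ∀ i j, u i * v j ≤ p i + w j) (A B T : E →L[ℂ] E)
    (hT : ∀ i x, HasSum (fun j => ((u i * v j : ℝ) : ℂ) *
      (inner ℂ (e i) (A (e j)) * inner ℂ (e j) (B x))) (inner ℂ (e i) (T x))) :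
    IsTraceClass T := by
  have hsum : ∀ (A : E →L[ℂ] E) {p : ι → ℝ}, Summable p → (∀ i, 0 ≤ p i) →
      ∃ s, HasSum (fun q : ι × ι => p q.1 * ‖inner ℂ (e q.2) (A (e q.1))‖ ^ 2) s ∧
        s ≤ ‖A‖ ^ 2 * ∑' i, p i := by
    intro A p hp hp0
    have h1 : ∀ i, p i * ‖A (e i)‖ ^ 2 ≤ ‖A‖ ^ 2 * p i := fun i => by
      have := A.le_opNorm (e i)
      rw [norm_hilbertBasis, mul_one] at this
      rw [mul_comm]
      exact mul_le_mul_of_nonneg_right (pow_le_pow_left₀ (norm_nonneg _) this 2) (hp0 i)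
    have h2 : Summable fun i => p i * ‖A (e i)‖ ^ 2 :=
      Summable.of_nonneg_of_le (fun i => mul_nonneg (hp0 i) (sq_nonneg _)) h1
        (hp.mul_left (‖A‖ ^ 2))
    refine ⟨∑' i, p i * ‖A (e i)‖ ^ 2,
      hasSum_prod_norm_inner_sq (v := fun i => A (e i)) e hp0 h2.hasSum, ?_⟩
    exact hasSum_le h1 h2.hasSum (hp.hasSum.mul_left _)
  refine isTraceClass_of_bound e T ((‖A‖ ^ 2 + ‖B‖ ^ 2) * (∑' i, p i + ∑' i, w i))
    fun Q hQ t ht => ?_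
  have hBQ : ‖B ∘L Q‖ ^ 2 ≤ ‖B‖ ^ 2 := by
    refine pow_le_pow_left₀ (norm_nonneg _) ((B.opNorm_comp_le Q).trans ?_) 2
    exact mul_le_of_le_one_right (norm_nonneg _) hQ
  obtain ⟨s1, h1, h1'⟩ := hsum A.adjoint hp hp0
  obtain ⟨s2, h2, h2'⟩ := hsum A hw hw0
  obtain ⟨s3, h3, h3'⟩ := hsum (B ∘L Q) hp hp0
  obtain ⟨s4, h4, h4'⟩ := hsum (B ∘L Q).adjoint hw hw0
  rw [LinearIsometryEquiv.norm_map] at h1' h4'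
  have h5 := ((h1.add ((Equiv.prodComm ι ι).hasSum_iff.2 h2)).add
    (h3.add ((Equiv.prodComm ι ι).hasSum_iff.2 h4)))
  have hP : 0 ≤ ∑' i, p i := tsum_nonneg hp0
  have hW : 0 ≤ ∑' i, w i := tsum_nonneg hw0
  set F : ι × ι → ℂ := fun q => ((u q.1 * v q.2 : ℝ) : ℂ) *
      (inner ℂ (e q.1) (A (e q.2)) * inner ℂ (e q.2) (B (Q (e q.1)))) with hF
  have hFle : ∀ q, ‖F q‖ ≤ p q.1 * ‖inner ℂ (e q.2) (A.adjoint (e q.1))‖ ^ 2 +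
      ((fun q : ι × ι => w q.1 * ‖inner ℂ (e q.2) (A (e q.1))‖ ^ 2) ∘ Equiv.prodComm ι ι) q +
      (p q.1 * ‖inner ℂ (e q.2) ((B ∘L Q) (e q.1))‖ ^ 2 +
      ((fun q : ι × ι => w q.1 * ‖inner ℂ (e q.2) ((B ∘L Q).adjoint (e q.1))‖ ^ 2) ∘
        Equiv.prodComm ι ι) q) := fun q => by
    simp only [Function.comp, Equiv.prodComm_apply, Prod.swap, hF]
    rw [← norm_inner_eq_adjoint, ← norm_inner_eq_adjoint, norm_mul, norm_mul, Complex.norm_real,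
      Real.norm_eq_abs, abs_of_nonneg (mul_nonneg (hu _) (hv _))]
    have hA := norm_nonneg (inner ℂ (e q.1) (A (e q.2)))
    have hB := norm_nonneg (inner ℂ (e q.2) ((B ∘L Q) (e q.1)))
    change _ * (_ * ‖inner ℂ (e q.2) ((B ∘L Q) (e q.1))‖) ≤ _
    set a := ‖inner ℂ (e q.1) (A (e q.2))‖
    set c := ‖inner ℂ (e q.2) ((B ∘L Q) (e q.1))‖
    have h6 : a * c ≤ a ^ 2 + c ^ 2 := by nlinarith [sq_nonneg (a - c), sq_nonneg a, sq_nonneg c]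
    have h7 := mul_le_mul (huv q.1 q.2) h6 (mul_nonneg hA hB) (add_nonneg (hp0 _) (hw0 _))
    linarith
  have hFs : Summable F := Summable.of_norm_bounded h5.summable hFle
  have h8 : HasSum (fun i => inner ℂ (e i) (T (Q (e i)))) (∑' q, F q) :=
    hFs.hasSum.prod_fiberwise fun i => hT i (Q (e i))
  rw [ht.unique h8]
  refine (tsum_of_norm_bounded h5 hFle).trans ?_
  nlinarith [mul_le_mul_of_nonneg_right hBQ hP, mul_le_mul_of_nonneg_right hBQ hW]

end HilbertSchmidt

/-! ### Operators diagonal in a Hilbert basis -/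

section Diagonal

variable {E : Type*} [NormedAddCommGroup E] [InnerProductSpace ℂ E]
variable {ι : Type*}

lemma exists_diag (e : HilbertBasis ι ℂ E) (d : ι → ℝ) (C : ℝ) (h : ∀ i, |d i| ≤ C) :
    ∃ T : E →L[ℂ] E, ∀ i, T (e i) = (d i : ℂ) • e i := by
  have hmem : ∀ x : E, Memℓp (fun i => (d i : ℂ) * inner ℂ (e i) x) 2 := fun x => by
    refine memℓp_gen ?_
    refine Summable.of_nonneg_of_le (fun i => by positivity) (fun i => ?_)
      ((hasSum_norm_inner_sq e x).summable.mul_left (C ^ 2))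
    simp only [ENNReal.toReal_ofNat, Real.rpow_ofNat]
    rw [norm_mul, mul_pow, Complex.norm_real, Real.norm_eq_abs]
    exact mul_le_mul_of_nonneg_right (pow_le_pow_left₀ (abs_nonneg _) (h i) 2) (sq_nonneg _)
  have hin : ∀ x i, inner ℂ (e i) (e.repr.symm ⟨_, hmem x⟩) = (d i : ℂ) * inner ℂ (e i) x :=
    fun x i => by
      rw [← e.repr_apply_apply, LinearIsometryEquiv.apply_symm_apply]
  let S : E →ₗ[ℂ] E :=
    { toFun := fun x => e.repr.symm ⟨_, hmem x⟩
      map_add' := fun x y => ext_hilbertBasis e fun i => by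
        rw [inner_add_right, hin, hin, hin, inner_add_right, mul_add]
      map_smul' := fun c x => ext_hilbertBasis e fun i => by
        rw [RingHom.id_apply, inner_smul_right, hin, hin, inner_smul_right, mul_left_comm] }
  have hS : ∀ x i, inner ℂ (e i) (S x) = (d i : ℂ) * inner ℂ (e i) x := hin
  refine ⟨S.mkContinuous |C| fun x => ?_, fun i => ?_⟩
  · rw [← sq_le_sq₀ (norm_nonneg _) (by positivity), mul_pow]
    refine hasSum_le (fun i => ?_) (hasSum_norm_inner_sq e (S x))
      ((hasSum_norm_inner_sq e x).mul_left (|C| ^ 2))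
    rw [hS, norm_mul, mul_pow, Complex.norm_real, Real.norm_eq_abs]
    exact mul_le_mul_of_nonneg_right
      (pow_le_pow_left₀ (abs_nonneg _) ((h i).trans (le_abs_self C)) 2) (sq_nonneg _)
  · classical
    refine ext_hilbertBasis e fun j => ?_
    rw [LinearMap.mkContinuous_apply, hS, inner_smul_right, inner_hilbertBasis]
    split_ifs with h
    · rw [h]
    · simp

variable [CompleteSpace E]

lemma adjoint_diag (e : HilbertBasis ι ℂ E) {T : E →L[ℂ] E} {d : ι → ℝ}
    (hT : ∀ i, T (e i) = (d i : ℂ) • e i) (i : ι) : T.adjoint (e i) = (d i : ℂ) • e i := by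
  classical
  refine ext_hilbertBasis e fun j => ?_
  rw [ContinuousLinearMap.adjoint_inner_right, hT, inner_smul_left, inner_smul_right,
    inner_hilbertBasis, Complex.conj_ofReal]
  split_ifs with h
  · rw [h]
  · simp

lemma inner_diag (e : HilbertBasis ι ℂ E) {T : E →L[ℂ] E} {d : ι → ℝ}
    (hT : ∀ i, T (e i) = (d i : ℂ) • e i) (i : ι) (x : E) :
    inner ℂ (e i) (T x) = d i * inner ℂ (e i) x := by
  rw [← ContinuousLinearMap.adjoint_inner_left, adjoint_diag e hT, inner_smul_left,
    Complex.conj_ofReal]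

lemma norm_diag_le (e : HilbertBasis ι ℂ E) {T : E →L[ℂ] E} {d : ι → ℝ}
    (hT : ∀ i, T (e i) = (d i : ℂ) • e i) {C : ℝ} (hC : 0 ≤ C) (h : ∀ i, |d i| ≤ C) :
    ‖T‖ ≤ C := by
  refine T.opNorm_le_bound hC fun x => ?_
  rw [← sq_le_sq₀ (norm_nonneg _) (by positivity), mul_pow]
  refine hasSum_le (fun i => ?_) (hasSum_norm_inner_sq e (T x))
    ((hasSum_norm_inner_sq e x).mul_left (C ^ 2))
  rw [inner_diag e hT, norm_mul, mul_pow, Complex.norm_real, Real.norm_eq_abs]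
  exact mul_le_mul_of_nonneg_right (pow_le_pow_left₀ (abs_nonneg _) (h i) 2) (sq_nonneg _)

/-- The finite rank truncations of $T$ converge in norm, since the discarded eigenvalues are
uniformly small. -/
lemma isCompactOperator_diag (e : HilbertBasis ι ℂ E) {T : E →L[ℂ] E} {d : ι → ℝ}
    (hT : ∀ i, T (e i) = (d i : ℂ) • e i) (hd : Filter.Tendsto d Filter.cofinite (𝓝 0)) :
    IsCompactOperator T := by
  classical
  let P : Finset ι → E →L[ℂ] E := fun F => ∑ k ∈ F, (innerSL ℂ (e k)).smulRight (e k)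
  have hP : ∀ F i, P F (e i) = if i ∈ F then e i else 0 := fun F i => by
    simp only [P, sum_apply, ContinuousLinearMap.smulRight_apply, innerSL_apply_apply,
      inner_hilbertBasis, ite_smul, one_smul, zero_smul]
    rw [Finset.sum_ite_eq']
  have hPc : ∀ F, IsCompactOperator (T ∘L P F) := fun F => by
    have h0 : ∀ k, IsCompactOperator ((innerSL ℂ (e k)).smulRight (e k)) := fun k => by
      have h1 : IsCompactOperator (innerSL ℂ (e k)) :=
        by
        exact isCompactOperator_of_locallyCompactSpace_dom _
      exact h1.continuous_comp (g := fun c : ℂ => c • e k) (by fun_prop)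
    have h1 : P F ∈ compactOperator (RingHom.id ℂ) E E :=
      Submodule.sum_mem _ fun k _ => h0 k
    exact IsCompactOperator.clm_comp (f := P F) h1 T
  refine isCompactOperator_of_tendsto (l := Filter.atTop) (F := fun F => T ∘L P F) ?_
    (Filter.Eventually.of_forall hPc)
  rw [Metric.tendsto_atTop]
  intro ε hε
  have h1 : {i | ¬ |d i| < ε / 2}.Finite := by
    have := hd.eventually (Metric.ball_mem_nhds 0 (half_pos hε))
    simpa [Filter.eventually_cofinite] using this
  refine ⟨h1.toFinset, fun F hF => ?_⟩
  rw [dist_eq_norm]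
  refine lt_of_le_of_lt ?_ (half_lt_self hε)
  refine norm_diag_le e (d := fun i => if i ∈ F then 0 else - d i) (fun i => ?_) (half_pos hε).le
    fun i => ?_
  · rw [sub_apply, ContinuousLinearMap.comp_apply, hP]
    split_ifs with h
    · simp
    · simp [hT]
  · split_ifs with h
    · simpa using (half_pos hε).le
    · rw [abs_neg]
      by_contra h2
      exact h (hF (h1.mem_toFinset.2 fun h3 => h2 h3.le))

end Diagonal

/-! ### Eigenbases and functional calculus on eigenvectors -/

section Eigenbasis

variable {E : Type*} [NormedAddCommGroup E] [InnerProductSpace ℂ E]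

lemma mem_spectrum_of_eigenvector {T : E →L[ℂ] E} {x : E} {μ : ℝ} (hx : T x = (μ : ℂ) • x)
    (hx0 : x ≠ 0) : μ ∈ spectrum ℝ T := by
  rw [spectrum.mem_iff]
  rintro ⟨u, hu⟩
  have h1 : (algebraMap ℝ (E →L[ℂ] E) μ - T) x = 0 := by
    rw [sub_apply, hx, Algebra.algebraMap_eq_smul_one, smul_apply, one_apply_eq_self,
      ← Complex.coe_smul, sub_self]
  rw [← hu] at h1
  apply hx0
  have h2 : ((u⁻¹ : (E →L[ℂ] E)ˣ) : E →L[ℂ] E) ((u : E →L[ℂ] E) x) = x := by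
    rw [← mul_apply_eq_comp, Units.inv_mul]
    rfl
  rw [← h2, h1, map_zero]

variable [CompleteSpace E]

/-- Hilbert bases of all eigenspaces, the kernel included, are glued. They are mutually orthogonal,
and the spectral theorem for compact symmetric operators makes their span dense. -/
lemma exists_eigenbasis.{u} {E : Type u} [NormedAddCommGroup E] [InnerProductSpace ℂ E]
    [CompleteSpace E] {T : E →L[ℂ] E} (hT : IsCompactOperator T)
    (hs : ∀ x y, inner ℂ (T x) y = inner ℂ x (T y)) :
    ∃ (ι : Type u) (e : HilbertBasis ι ℂ E) (d : ι → ℝ), ∀ i, T (e i) = (d i : ℂ) • e i := by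
  have hsym : T.IsSymmetric := hs
  let V : ℂ → Submodule ℂ E := fun μ => Module.End.eigenspace (T : Module.End ℂ E) μ
  have hVc : ∀ μ, IsClosed (V μ : Set E) := fun μ => by
    have : (V μ : Set E) = {x | T x = μ • x} := by
      ext x
      exact Module.End.mem_eigenspace_iff
    rw [this]
    exact isClosed_eq T.continuous (continuous_const_smul μ)
  have : ∀ μ, CompleteSpace (V μ) := fun μ => (hVc μ).completeSpace_coe
  have hO : OrthogonalFamily ℂ (fun μ => V μ) fun μ => (V μ).subtypeₗᵢ :=
    hsym.orthogonalFamily_eigenspaces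
  let b : ∀ μ, HilbertBasis (basisIndex (V μ)) ℂ (V μ) := fun μ => basis (V μ)
  let v : (Σ μ, basisIndex (V μ)) → E := fun a => (b a.1 a.2 : E)
  have hv : Orthonormal ℂ v := hO.orthonormal_sigma_orthonormal fun μ => (b μ).orthonormal
  have hsp : (Submodule.span ℂ (Set.range v))ᗮ = ⊥ := by
    rw [← ContinuousLinearMap.orthogonalComplement_iSup_eigenspaces_eq_bot hT hsym]
    refine le_antisymm (fun z hz => ?_) (Submodule.orthogonal_le ?_)
    · rw [← Submodule.iInf_orthogonal, Submodule.mem_iInf]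
      intro μ u hu
      have h1 := (((b μ).hasSum_repr ⟨u, hu⟩).mapL (V μ).subtypeL).mapL (innerSL ℂ z)
      have h2 : ∀ k, innerSL ℂ z ((V μ).subtypeL ((b μ).repr ⟨u, hu⟩ k • b μ k)) = 0 := fun k => by
        have h3 := (Submodule.mem_orthogonal' _ _).1 hz (v ⟨μ, k⟩)
          (Submodule.subset_span ⟨_, rfl⟩)
        rw [map_smul, map_smul, innerSL_apply_apply]
        exact smul_eq_zero_of_right _ h3
      simp only [h2] at h1
      exact inner_eq_zero_symm.1 (h1.unique hasSum_zero)
    · rw [Submodule.span_le]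
      rintro _ ⟨a, rfl⟩
      exact Submodule.mem_iSup_of_mem a.1 (b a.1 a.2).2
  have he : ∀ a, T (v a) = a.1 • v a := fun a =>
    Module.End.mem_eigenspace_iff.1 (b a.1 a.2).2
  refine ⟨_, HilbertBasis.mkOfOrthogonalEqBot hv hsp, fun a => a.1.re, fun a => ?_⟩
  rw [HilbertBasis.coe_mkOfOrthogonalEqBot, he]
  congr 1
  have hn : ‖v a‖ = 1 := hv.1 a
  have h1 := hs (v a) (v a)
  rw [he, inner_smul_left, inner_smul_right, inner_self_eq_norm_sq_to_K, hn] at h1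
  simp at h1
  exact (Complex.conj_eq_iff_re.1 h1).symm

/-- Clear for polynomials, hence for continuous functions on the compact spectrum by
Stone–Weierstrass. -/
lemma cfc_apply_eigenvector {T : E →L[ℂ] E} (hT : IsSelfAdjoint T) {f : ℝ → ℝ}
    (hf : ContinuousOn f (spectrum ℝ T)) {x : E} {μ : ℝ} (hx : T x = (μ : ℂ) • x)
    (hx0 : x ≠ 0) : cfc f T x = (f μ : ℂ) • x := by
  have hμ := mem_spectrum_of_eigenvector hx hx0
  rw [cfc_apply f T hT hf]
  have hc : CompactSpace (spectrum ℝ T) := isCompact_iff_compactSpace.1 (spectrum.isCompact T)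
  suffices h : ∀ g : C(spectrum ℝ T, ℝ), cfcHom hT g x = ((g ⟨μ, hμ⟩ : ℝ) : ℂ) • x from h _
  intro g
  have hid : cfcHom hT (.restrict (spectrum ℝ T) <| .id ℝ) x =
      ((((ContinuousMap.id ℝ).restrict (spectrum ℝ T)) ⟨μ, hμ⟩ : ℝ) : ℂ) • x := by
    rw [cfcHom_id hT, hx]
    rfl
  induction g using ContinuousMap.induction_on_of_compact with
  | const r =>
    have : ContinuousMap.const (spectrum ℝ T) r = algebraMap ℝ _ r := rfl
    rw [this, AlgHomClass.commutes, Algebra.algebraMap_eq_smul_one, smul_apply, one_apply_eq_self,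
      ← Complex.coe_smul]
    simp
  | id => exact hid
  | star_id =>
    rw [star_trivial]
    exact hid
  | add f g hf hg =>
    rw [map_add, add_apply, hf, hg, ContinuousMap.add_apply]
    push_cast
    rw [add_smul]
  | mul f g hf hg =>
    rw [map_mul, mul_apply_eq_comp, hg, map_smul, hf, smul_smul, ContinuousMap.mul_apply]
    push_cast
    rw [mul_comm]
  | frequently f hf =>
    have hcl : IsClosed {g : C(spectrum ℝ T, ℝ) | cfcHom hT g x = ((g ⟨μ, hμ⟩ : ℝ) : ℂ) • x} := by
      refine isClosed_eq ?_ ?_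
      · exact (ContinuousLinearMap.apply ℂ E x).continuous.comp (cfcHom_continuous hT)
      · have := ContinuousEvalConst.continuous_eval_const (F := C(spectrum ℝ T, ℝ)) ⟨μ, hμ⟩
        fun_prop
    exact hcl.mem_of_frequently_of_tendsto hf Filter.tendsto_id

lemma rpow_apply_eigenvector {T : E →L[ℂ] E} (hT : 0 ≤ T) {α : ℝ} (hα : 0 ≤ α) {x : E} {μ : ℝ}
    (hx : T x = (μ : ℂ) • x) (hx0 : x ≠ 0) : (T ^ α) x = ((μ ^ α : ℝ) : ℂ) • x := by
  rw [CFC.rpow_eq_cfc_real (ha := hT)]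
  refine cfc_apply_eigenvector hT.isSelfAdjoint ?_ hx hx0
  exact (Real.continuous_rpow_const hα).continuousOn

end Eigenbasis

/-! ### Unbounded operators with an eigenbasis -/

section Diagonalized

variable {E : Type*} [NormedAddCommGroup E] [InnerProductSpace ℂ E]

lemma ne_zero_basis {ι : Type*} (e : HilbertBasis ι ℂ E) (i : ι) : e i ≠ 0 := by
  rw [← norm_ne_zero_iff, norm_hilbertBasis]
  exact one_ne_zero

/-- `A` is a positive self-adjoint operator with bounded inverse that is diagonal in the Hilbert
basis `e`, with eigenvalues `l`. -/
structure IsDiagonalized {ι : Type*} (A : E →ₗ.[ℂ] E) (e : HilbertBasis ι ℂ E) (l : ι → ℝ) :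
    Prop where
  pos : ∀ i, 0 < l i
  mem : ∀ i, e i ∈ A.domain
  apply : ∀ i, A ⟨e i, mem i⟩ = (l i : ℂ) • e i
  symm : ∀ x y : A.domain, inner ℂ (A x) (y : E) = inner ℂ (x : E) (A y)
  surj : ∀ y, ∃ x, A x = y
  inv : ∃ R : E →L[ℂ] E, ∀ x, R (A x) = x

lemma bddInv_apply {A : E →ₗ.[ℂ] E} (hinv : ∃ R : E →L[ℂ] E, ∀ x, R (A x) = x)
    (x : A.domain) : bddInv A (A x) = x := by
  obtain ⟨R, hR⟩ := hinv
  have hker : LinearMap.ker A.toFun = ⊥ := by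
    rw [LinearMap.ker_eq_bot']
    intro z hz
    have h1 : A z = 0 := hz
    have h2 := hR z
    rw [h1, map_zero] at h2
    exact Subtype.ext h2.symm
  have hval : ∀ y : A.inverse.domain, R y = A.inverse y := fun y => by
    have hy : (y : E) ∈ LinearMap.range A.toFun := by
      rw [← LinearPMap.inverse_domain]; exact y.2
    obtain ⟨z, hz⟩ := hy
    have h3 : A z = y := hz
    rw [LinearPMap.inverse_apply_eq hker (y := y) h3, ← h3, hR]
  have hmem : A x ∈ A.inverse.domain := by
    rw [LinearPMap.inverse_domain]; exact ⟨x, rfl⟩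
  have h4 := bddExt_apply A.inverse ⟨R, hval⟩ ⟨A x, hmem⟩
  exact h4.trans (LinearPMap.inverse_apply_eq hker (y := ⟨A x, hmem⟩) rfl)

lemma bddInv_eq {A : E →ₗ.[ℂ] E} (hsurj : ∀ y, ∃ x, A x = y) {R : E →L[ℂ] E}
    (hR : ∀ x, R (A x) = x) : bddInv A = R := by
  refine ContinuousLinearMap.ext fun y => ?_
  obtain ⟨x, rfl⟩ := hsurj y
  rw [bddInv_apply ⟨R, hR⟩, hR]

lemma bddExt_eq {A : E →ₗ.[ℂ] E} (hd : Dense (A.domain : Set E)) {T : E →L[ℂ] E}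
    (hT : ∀ x : A.domain, T x = A x) : bddExt A = T := by
  refine ContinuousLinearMap.ext fun v => ?_
  refine congrFun (Continuous.ext_on hd (bddExt A).continuous T.continuous fun x hx => ?_) v
  rw [bddExt_apply A ⟨T, hT⟩ ⟨x, hx⟩]
  exact (hT ⟨x, hx⟩).symm

/-- Transfers an eigenbasis from the bounded inverse, where the compact spectral theorem applies, to
the unbounded operator. -/
lemma apply_of_inv_eigenvector {A : E →ₗ.[ℂ] E} (hsurj : ∀ y, ∃ x, A x = y) {R : E →L[ℂ] E}
    (hR : ∀ x, R (A x) = x) {v : E} (hv : v ≠ 0) {d : ℝ} (hd : R v = (d : ℂ) • v) :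
    d ≠ 0 ∧ ∃ h : v ∈ A.domain, A ⟨v, h⟩ = ((d⁻¹ : ℝ) : ℂ) • v := by
  have hd0 : d ≠ 0 := by
    rintro rfl
    obtain ⟨x, rfl⟩ := hsurj v
    rw [Complex.ofReal_zero, zero_smul, hR] at hd
    apply hv
    rw [Subtype.ext (a1 := x) (a2 := 0) hd, LinearPMap.map_zero]
  refine ⟨hd0, ?_⟩
  obtain ⟨x, hx⟩ := hsurj (((d⁻¹ : ℝ) : ℂ) • v)
  have h1 : (x : E) = v := by
    rw [← hR x, hx, map_smul, hd, smul_smul, ← Complex.ofReal_mul, inv_mul_cancel₀ hd0,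
      Complex.ofReal_one, one_smul]
  subst h1
  exact ⟨x.2, hx⟩

namespace IsDiagonalized

variable {ι : Type*} {A : E →ₗ.[ℂ] E} {e : HilbertBasis ι ℂ E} {l : ι → ℝ}

lemma dense (h : IsDiagonalized A e l) : Dense (A.domain : Set E) := by
  have h1 : Submodule.span ℂ (Set.range e) ≤ A.domain := by
    rw [Submodule.span_le]
    rintro _ ⟨i, rfl⟩
    exact h.mem i
  refine Dense.mono (s₁ := (Submodule.span ℂ (Set.range e) : Set E)) h1 ?_
  rw [dense_iff_closure_eq, ← Submodule.topologicalClosure_coe, e.dense_span]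
  rfl

lemma bddInv_apply (h : IsDiagonalized A e l) (x : A.domain) : bddInv A (A x) = x :=
  BKM.bddInv_apply h.inv x

lemma bddInv_mem (h : IsDiagonalized A e l) (y : E) : bddInv A y ∈ A.domain := by
  obtain ⟨x, rfl⟩ := h.surj y
  rw [h.bddInv_apply]
  exact x.2

lemma bddInv_basis (h : IsDiagonalized A e l) (i : ι) :
    bddInv A (e i) = (((l i)⁻¹ : ℝ) : ℂ) • e i := by
  have h1 := h.bddInv_apply ⟨e i, h.mem i⟩
  rw [h.apply, map_smul] at h1
  have h2 : (l i : ℂ) ≠ 0 := by exact_mod_cast (h.pos i).ne'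
  change _ = e i at h1
  rw [Complex.ofReal_inv, eq_inv_smul_iff₀ h2, h1]

lemma inner_apply (h : IsDiagonalized A e l) (i : ι) (x : A.domain) :
    inner ℂ (e i) (A x) = l i * inner ℂ (e i) (x : E) := by
  have := h.symm ⟨e i, h.mem i⟩ x
  rw [← this, h.apply, inner_smul_left, Complex.conj_ofReal]

lemma bddInv_symm (h : IsDiagonalized A e l) (x y : E) :
    inner ℂ (bddInv A x) y = inner ℂ x (bddInv A y) := by
  obtain ⟨u, rfl⟩ := h.surj x
  obtain ⟨v, rfl⟩ := h.surj y
  rw [h.bddInv_apply, h.bddInv_apply, h.symm]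

variable [CompleteSpace E]

lemma isSelfAdjoint_bddInv (h : IsDiagonalized A e l) : IsSelfAdjoint (bddInv A) := by
  rw [ContinuousLinearMap.isSelfAdjoint_iff_isSymmetric]
  exact h.bddInv_symm

lemma expNeg_basis (h : IsDiagonalized A e l) (i : ι) :
    expNeg A (e i) = ((Real.exp (-l i) : ℝ) : ℂ) • e i := by
  rw [expNeg, cfc_apply_eigenvector h.isSelfAdjoint_bddInv
    (expNegInvGlue.contDiff (n := 0)).continuous.continuousOn (h.bddInv_basis i) (ne_zero_basis e i)]
  rw [expNegInvGlue, if_neg (not_le.2 (inv_pos.2 (h.pos i))), inv_inv]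

end IsDiagonalized

lemma expNeg_nonneg [CompleteSpace E] (A : E →ₗ.[ℂ] E) : 0 ≤ expNeg A :=
  cfc_nonneg fun x _ => expNegInvGlue.nonneg x

end Diagonalized

/-! ### Jensen's inequality in an eigenbasis -/

section Jensen

variable {E : Type*} [NormedAddCommGroup E] [InnerProductSpace ℂ E]
variable {ι κ : Type*}

/-- Jensen's inequality for the spectral measure of a vector. -/
lemma IsDiagonalized.exp_neg_le {A : E →ₗ.[ℂ] E} {e : HilbertBasis ι ℂ E} {l : ι → ℝ}
    (h : IsDiagonalized A e l) {β : ℝ} (hβ : 0 ≤ β) (hs : Summable fun i => Real.exp (-(β * l i)))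
    (x : A.domain) (hx : ‖(x : E)‖ = 1) :
    Real.exp (-(β * ‖A x‖)) ≤ ∑' i, Real.exp (-(β * l i)) * ‖inner ℂ (e i) (x : E)‖ ^ 2 := by
  set q := (inner ℂ (x : E) (A x)).re with hq
  have hqle : q ≤ ‖A x‖ := by
    have h1 := (Complex.re_le_norm _).trans (norm_inner_le_norm (𝕜 := ℂ) (x : E) (A x))
    rwa [hx, one_mul] at h1
  have h1 : HasSum (fun i => ‖inner ℂ (e i) (x : E)‖ ^ 2) 1 := by
    have := hasSum_norm_inner_sq e (x : E)
    rwa [hx, one_pow] at this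
  have h2 : HasSum (fun i => l i * ‖inner ℂ (e i) (x : E)‖ ^ 2) q := by
    have h3 := Complex.hasSum_re (e.hasSum_inner_mul_inner (x : E) (A x))
    refine h3.congr_fun fun i => ?_
    rw [h.inner_apply, mul_left_comm, ← inner_conj_symm (x : E), Complex.conj_mul']
    norm_cast
  -- The tangent line of $e^{-\beta t}$ at the mean $t=q$, summed against the spectral weights: its
  -- linear part cancels and $e^{-\beta q}$ remains.
  have h4 : HasSum (fun i => Real.exp (-(β * q)) * ((1 + β * q) * ‖inner ℂ (e i) (x : E)‖ ^ 2 -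
      β * (l i * ‖inner ℂ (e i) (x : E)‖ ^ 2)))
      (Real.exp (-(β * q)) * ((1 + β * q) * 1 - β * q)) :=
    ((h1.mul_left _).sub (h2.mul_left _)).mul_left _
  have h5 : Summable fun i => Real.exp (-(β * l i)) * ‖inner ℂ (e i) (x : E)‖ ^ 2 := by
    refine Summable.of_nonneg_of_le (fun i => by positivity) (fun i => ?_) hs
    refine mul_le_of_le_one_right (Real.exp_nonneg _) ?_
    exact le_hasSum h1 i fun _ _ => by positivity
  have h6 := hasSum_le (fun i => ?_) h4 h5.hasSum
  · refine le_trans ?_ h6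
    rw [mul_one, add_sub_cancel_right, mul_one]
    exact Real.exp_le_exp.2 (neg_le_neg (mul_le_mul_of_nonneg_left hqle hβ))
  · have h7 : Real.exp (-(β * q)) * (1 + β * q - β * l i) ≤ Real.exp (-(β * l i)) := by
      have h8 : -(β * l i) = -(β * q) + (β * q - β * l i) := by ring
      rw [h8, Real.exp_add]
      refine mul_le_mul_of_nonneg_left ?_ (Real.exp_nonneg _)
      have := Real.add_one_le_exp (β * q - β * l i)
      linarith
    have h9 := mul_le_mul_of_nonneg_right h7 (sq_nonneg ‖inner ℂ (e i) (x : E)‖)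
    calc _ = _ := by ring
      _ ≤ _ := h9

end Jensen

/-! ### Diagonalization of $H_0$ -/

section Unperturbed

open Filter

/-- The value at $0$ is $0$ by the conventions for `Real.log` and inversion, which agrees with the
limit because $\log t\to-\infty$. -/
lemma continuousAt_neg_inv_log_zero : ContinuousAt (fun t : ℝ => -(Real.log t)⁻¹) 0 := by
  rw [continuousAt_iff_punctured_nhds]
  have h := (Real.tendsto_log_nhdsNE_zero.inv_tendsto_atBot).neg
  simpa using h

lemma neg_inv_log_expNegInvGlue {r : ℝ} (hr : 0 ≤ r) : -(Real.log (expNegInvGlue r))⁻¹ = r := by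
  rcases hr.eq_or_lt with rfl | hr
  · simp [expNegInvGlue.zero]
  · rw [expNegInvGlue, if_neg (not_le.2 hr), Real.log_exp, inv_neg, inv_inv, neg_neg]

variable {E : Type*} [NormedAddCommGroup E] [InnerProductSpace ℂ E] [CompleteSpace E]

namespace Hamiltonian

lemma R_nonneg (H : Hamiltonian E) : 0 ≤ H.R := by
  rw [ContinuousLinearMap.nonneg_iff_isPositive]
  refine ⟨H.R_symm, fun x => ?_⟩
  obtain ⟨u, rfl⟩ := H.exists_pre x
  rw [ContinuousLinearMap.reApplyInnerSelf_apply, H.R_op]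
  have := H.one_le u
  exact le_trans (by positivity) this

lemma spectrum_R_nonneg (H : Hamiltonian E) {r : ℝ} (hr : r ∈ spectrum ℝ H.R) : 0 ≤ r :=
  spectrum_nonneg_of_nonneg H.R_nonneg hr

lemma continuousOn_image_spectrum_R (H : Hamiltonian E) :
    ContinuousOn (fun t : ℝ => -(Real.log t)⁻¹) (expNegInvGlue '' spectrum ℝ H.R) := by
  rintro _ ⟨r, hr, rfl⟩
  refine ContinuousAt.continuousWithinAt ?_
  rcases (H.spectrum_R_nonneg hr).eq_or_lt with rfl | hr
  · rw [expNegInvGlue.zero]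
    exact continuousAt_neg_inv_log_zero
  · have h2 : 0 < expNegInvGlue r := expNegInvGlue.pos_of_pos hr
    have h3 : Real.log (expNegInvGlue r) ≠ 0 := by
      rw [expNegInvGlue, if_neg (not_le.2 hr), Real.log_exp]
      exact neg_ne_zero.2 (inv_ne_zero hr.ne')
    exact ((Real.continuousAt_log h2.ne').inv₀ h3).neg

/-- The map $t\mapsto-1/\log t$ undoes $r\mapsto e^{-1/r}$ on $r\ge0$. Eigenvectors of the compact
operator $e^{-H}$ are therefore eigenvectors of $H^{-1}$. -/
lemma R_eq_cfc (H : Hamiltonian E) :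
    H.R = cfc (fun t : ℝ => -(Real.log t)⁻¹) (expNeg H.op) := by
  have hsa : IsSelfAdjoint H.R := H.R_nonneg.isSelfAdjoint
  have h1 : cfc (fun r => -(Real.log (expNegInvGlue r))⁻¹) H.R = H.R := by
    conv_rhs => rw [← cfc_id' ℝ H.R]
    exact cfc_congr fun r hr => neg_inv_log_expNegInvGlue (H.spectrum_R_nonneg hr)
  conv_lhs => rw [← h1]
  exact cfc_comp' (fun t : ℝ => -(Real.log t)⁻¹) expNegInvGlue H.R
    H.continuousOn_image_spectrum_R (expNegInvGlue.contDiff (n := 0)).continuous.continuousOn hsa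

lemma exists_isDiagonalized.{u} {E : Type u} [NormedAddCommGroup E] [InnerProductSpace ℂ E]
    [CompleteSpace E] (H : Hamiltonian E) {β : ℝ} (hβ : 0 < β)
    (hH : IsSchatten β (expNeg H.op)) :
    ∃ (ι : Type u) (g : HilbertBasis ι ℂ E) (l : ι → ℝ), IsDiagonalized H.op g l ∧
      (Summable fun i => Real.exp (-(β * l i))) ∧ IsCompactOperator H.R := by
  have hK : 0 ≤ expNeg H.op := expNeg_nonneg H.op
  have hKs : IsSelfAdjoint (expNeg H.op) := hK.isSelfAdjoint
  have hKc : IsCompactOperator (expNeg H.op) := hH.1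
  obtain ⟨ι, g, k, hk⟩ := exists_eigenbasis hKc (inner_apply_of_isSelfAdjoint hKs)
  have hcont : ContinuousOn (fun t : ℝ => -(Real.log t)⁻¹) (spectrum ℝ (expNeg H.op)) := by
    have := H.continuousOn_image_spectrum_R
    rwa [← cfc_map_spectrum expNegInvGlue H.R H.R_nonneg.isSelfAdjoint
      (expNegInvGlue.contDiff (n := 0)).continuous.continuousOn] at this
  obtain ⟨r, hR⟩ : ∃ r : ι → ℝ, ∀ i, H.R (g i) = (r i : ℂ) • g i := by
    refine ⟨fun i => -(Real.log (k i))⁻¹, fun i => ?_⟩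
    rw [H.R_eq_cfc]
    exact cfc_apply_eigenvector hKs hcont (hk i) (ne_zero_basis g i)
  have hap := fun i => apply_of_inv_eigenvector H.exists_pre H.R_op (ne_zero_basis g i) (hR i)
  have hpos : ∀ i, 0 < r i := fun i => by
    refine lt_of_le_of_ne ?_ (hap i).1.symm
    have h1 := ((ContinuousLinearMap.nonneg_iff_isPositive _).1 H.R_nonneg).2 (g i)
    rw [ContinuousLinearMap.reApplyInnerSelf_apply, hR, inner_smul_left,
      inner_self_eq_norm_sq_to_K, norm_hilbertBasis] at h1
    simpa using h1
  have hD : IsDiagonalized H.op g fun i => (r i)⁻¹ :=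
    { pos := fun i => inv_pos.2 (hpos i)
      mem := fun i => (hap i).2.choose
      apply := fun i => (hap i).2.choose_spec
      symm := H.symm
      surj := H.exists_pre
      inv := ⟨H.R, H.R_op⟩ }
  -- The trace of $|e^{-H}|^\beta$, computed in the eigenbasis.
  have hsum : Summable fun i => Real.exp (-(β * (r i)⁻¹)) := by
    have h1 := hH.2.hasSum g
    rw [CFC.abs_of_nonneg _ hK] at h1
    refine (Complex.hasSum_re h1).summable.congr fun i => ?_
    rw [rpow_apply_eigenvector hK hβ.le (hD.expNeg_basis i) (ne_zero_basis g i),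
      inner_smul_right, inner_self_eq_norm_sq_to_K, norm_hilbertBasis, ← Real.exp_mul]
    rw [neg_mul, mul_comm _ β]
    simp [-Complex.ofReal_exp]
  refine ⟨ι, g, _, hD, hsum, isCompactOperator_diag g hR ?_⟩
  -- Summability forces $e^{-\beta/r_i}\to0$, and $-\beta/\log(e^{-\beta/r_i})=r_i$; hence $r_i\to0$
  -- and $R$ is compact.
  have h2 := (continuousAt_neg_inv_log_zero.tendsto.comp hsum.tendsto_cofinite_zero).const_mul β
  simp only [Real.log_zero, inv_zero, neg_zero, mul_zero] at h2
  refine h2.congr fun i => ?_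
  have := (hpos i).ne'
  simp only [Function.comp, Real.log_exp]
  field_simp

end Hamiltonian

end Unperturbed

/-! ### Diagonalization of $H+V$ and the trace bound -/

section Perturbed

variable {E : Type*} [NormedAddCommGroup E] [InnerProductSpace ℂ E] [CompleteSpace E]

namespace Hamiltonian

variable (H : Hamiltonian E)

lemma R_mem (y : E) : H.R y ∈ H.op.domain := by
  obtain ⟨z, rfl⟩ := H.exists_pre y
  rw [R_op]
  exact z.2

lemma op_R (y : E) : H.op ⟨H.R y, H.R_mem y⟩ = y := by
  obtain ⟨z, rfl⟩ := H.exists_pre y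
  congr 1
  exact Subtype.ext (H.R_op z)

/-- The bounded operator `V R`. -/
lemma adjoint_omegaMap_apply (V : omegaDirections H.op) (x : H.op.domain) :
    (H.omegaMap V).adjoint (H.op x) = V.1 x := by
  refine H.dense.eq_of_inner_right (𝕜 := ℂ) fun y hy => ?_
  have h := H.bddExt_R_apply V ⟨y, hy⟩
  change H.omegaMap V y = _ at h
  rw [ContinuousLinearMap.adjoint_inner_right, h, H.R_symm, H.R_op]
  exact V.2.1 ⟨y, hy⟩ x

lemma norm_apply_le (V : omegaDirections H.op) (x : H.op.domain) :
    ‖V.1 x‖ ≤ ‖V‖ * ‖H.op x‖ := by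
  rw [← H.adjoint_omegaMap_apply]
  refine (ContinuousLinearMap.le_opNorm _ _).trans_eq ?_
  rw [LinearIsometryEquiv.norm_map]
  rfl

lemma perturb_symm (V : omegaDirections H.op) (x y : (perturb H.op V.1).domain) :
    inner ℂ (perturb H.op V.1 x) (y : E) = inner ℂ (x : E) (perturb H.op V.1 y) := by
  have h : ∀ u v : H.op.domain,
      inner ℂ (H.op u + V.1 u) (v : E) = inner ℂ (u : E) (H.op v + V.1 v) := fun u v => by
    rw [inner_add_left, inner_add_right, H.symm, V.2.1]
  exact h x y

/-- Factor $H+V=(1+VR)H$ and invert $1+VR$ by a Neumann series. The form $RW$ of the inverse makes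
it compact when $R$ is. -/
lemma exists_inv_perturb (V : omegaDirections H.op) (hV : ‖V‖ < 1) :
    ∃ W : E →L[ℂ] E, (∀ x, (H.R ∘L W) (perturb H.op V.1 x) = x) ∧
      ∀ y, ∃ x, perturb H.op V.1 x = y := by
  set B := (H.omegaMap V).adjoint with hB
  have hBn : ‖-B‖ < 1 := by
    rw [norm_neg, hB, LinearIsometryEquiv.norm_map]
    exact hV
  let U := Units.oneSub (-B) hBn
  have hU : ∀ x, (U : E →L[ℂ] E) x = x + B x := fun x => by
    simp [U]
  have hA : ∀ x : H.op.domain, perturb H.op V.1 x = (U : E →L[ℂ] E) (H.op x) := fun x => by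
    rw [hU, hB]
    exact congrArg (H.op x + ·) (H.adjoint_omegaMap_apply V x).symm
  have hl : ∀ y, ((U⁻¹ : (E →L[ℂ] E)ˣ) : E →L[ℂ] E) ((U : E →L[ℂ] E) y) = y := fun y => by
    rw [← mul_apply_eq_comp, Units.inv_mul, one_apply_eq_self]
  have hr : ∀ y, (U : E →L[ℂ] E) (((U⁻¹ : (E →L[ℂ] E)ˣ) : E →L[ℂ] E) y) = y := fun y => by
    rw [← mul_apply_eq_comp, Units.mul_inv, one_apply_eq_self]
  refine ⟨((U⁻¹ : (E →L[ℂ] E)ˣ) : E →L[ℂ] E), fun x => ?_, fun y => ?_⟩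
  · refine (congrArg _ (hA x)).trans ?_
    rw [ContinuousLinearMap.comp_apply, hl]
    exact H.R_op x
  · refine ⟨⟨H.R (((U⁻¹ : (E →L[ℂ] E)ˣ) : E →L[ℂ] E) y), H.R_mem _⟩, (hA _).trans ?_⟩
    exact (congrArg _ (H.op_R _)).trans (hr y)

/-- A real eigenvalue of `H + V` is positive if `‖V‖ < 1`. -/
lemma eigenvalue_pos (V : omegaDirections H.op) (hV : ‖V‖ < 1) {x : H.op.domain}
    (hx : ‖(x : E)‖ = 1) {l : ℝ} (hl : H.op x + V.1 x = (l : ℂ) • (x : E)) : 0 < l := by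
  by_contra! h0
  have h1 : H.op x - (l : ℂ) • (x : E) = - V.1 x := by
    rw [← hl]
    abel
  -- If $l\le0$, positivity of $H$ makes the cross term nonnegative. Then
  -- $\|Hx\|\le\|Vx\|\le\|V\|\|Hx\|$, impossible since $\|Hx\|\ge1$.
  have h2 : ‖H.op x‖ ^ 2 ≤ ‖H.op x - (l : ℂ) • (x : E)‖ ^ 2 := by
    rw [norm_sub_sq (𝕜 := ℂ), inner_smul_right]
    have h3 := H.one_le x
    rw [← inner_conj_symm, Complex.conj_re] at h3
    have h4 : RCLike.re ((l : ℂ) * inner ℂ (H.op x) (x : E)) =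
        l * (inner ℂ (H.op x) (x : E)).re := by simp
    rw [h4]
    rw [hx] at h3
    nlinarith [sq_nonneg ‖(l : ℂ) • (x : E)‖]
  rw [h1, norm_neg] at h2
  have h5 : ‖H.op x‖ ≤ ‖V.1 x‖ := (sq_le_sq₀ (norm_nonneg _) (norm_nonneg _)).1 h2
  have h6 := H.norm_apply_le V x
  have h7 := H.norm_le x
  rw [hx] at h7
  nlinarith

lemma exists_isDiagonalized_perturb.{u} {E : Type u} [NormedAddCommGroup E]
    [InnerProductSpace ℂ E] [CompleteSpace E] (H : Hamiltonian E) (hc : IsCompactOperator H.R)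
    (V : omegaDirections H.op) (hV : ‖V‖ < 1) :
    ∃ (ι : Type u) (e : HilbertBasis ι ℂ E) (l : ι → ℝ),
      IsDiagonalized (perturb H.op V.1) e l := by
  obtain ⟨W, hW, hsurj⟩ := H.exists_inv_perturb V hV
  have hs : ∀ x y, inner ℂ ((H.R ∘L W) x) y = inner ℂ x ((H.R ∘L W) y) := fun x y => by
    obtain ⟨u, rfl⟩ := hsurj x
    obtain ⟨v, rfl⟩ := hsurj y
    rw [hW, hW, H.perturb_symm]
  obtain ⟨ι, e, d, hd⟩ := exists_eigenbasis (T := H.R ∘L W) (hc.comp_clm W) hs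
  have hap := fun i => apply_of_inv_eigenvector hsurj hW (ne_zero_basis e i) (hd i)
  exact ⟨ι, e, fun i => (d i)⁻¹,
    { pos := fun i => H.eigenvalue_pos V hV (norm_hilbertBasis e i) (hap i).2.choose_spec
      mem := fun i => (hap i).2.choose
      apply := fun i => (hap i).2.choose_spec
      symm := H.perturb_symm V
      surj := hsurj
      inv := ⟨_, hW⟩ }⟩

lemma norm_op_basis_le {ι : Type*} (V : omegaDirections H.op)
    {e : HilbertBasis ι ℂ E} {l : ι → ℝ} (h : IsDiagonalized (perturb H.op V.1) e l) (i : ι) :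
    (1 - ‖V‖) * ‖H.op ⟨e i, h.mem i⟩‖ ≤ l i := by
  have h1 : H.op ⟨e i, h.mem i⟩ + V.1 ⟨e i, h.mem i⟩ = (l i : ℂ) • e i := h.apply i
  have h2 := H.norm_apply_le V ⟨e i, h.mem i⟩
  have h3 : ‖H.op ⟨e i, h.mem i⟩‖ ≤ l i + ‖V.1 ⟨e i, h.mem i⟩‖ := by
    rw [eq_sub_of_add_eq h1]
    refine (norm_sub_le _ _).trans_eq ?_
    rw [norm_smul, norm_hilbertBasis, Complex.norm_real, Real.norm_eq_abs,
      abs_of_pos (h.pos i), mul_one]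
  linarith

/-- `Tr e^{-s (H + V)}` is bounded by `Tr e^{-β H}` if `β ≤ s (1 - ‖V‖)`. -/
lemma summable_exp_perturb {ι κ : Type*} {g : HilbertBasis κ ℂ E} {k : κ → ℝ}
    (hg : IsDiagonalized H.op g k) {β : ℝ} (hβ : 0 ≤ β)
    (hs : Summable fun i => Real.exp (-(β * k i))) (V : omegaDirections H.op)
    {e : HilbertBasis ι ℂ E} {l : ι → ℝ} (h : IsDiagonalized (perturb H.op V.1) e l) {s : ℝ}
    (hs0 : 0 ≤ s) (hsβ : β ≤ s * (1 - ‖V‖)) :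
    (Summable fun i => Real.exp (-(s * l i))) ∧
      ∑' i, Real.exp (-(s * l i)) ≤ ∑' j, Real.exp (-(β * k j)) := by
  have h1 : HasSum (fun j => Real.exp (-(β * k j)) * ‖g j‖ ^ 2) (∑' j, Real.exp (-(β * k j))) := by
    simpa only [norm_hilbertBasis, one_pow, mul_one] using hs.hasSum
  -- The matrix $|\langle g_j,e_i\rangle|^2$ is doubly stochastic, so summing the Jensen bounds over
  -- $i$ returns exactly $\sum_je^{-\beta k_j}$.
  have h2 := hasSum_prod_norm_inner_sq e (fun j => Real.exp_nonneg _) h1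
  have h3 := (Equiv.prodComm ι κ).hasSum_iff.2 h2
  have h4 := h3.prod_fiberwise fun i => (h3.summable.prod_factor i).hasSum
  have hle : ∀ i, Real.exp (-(s * l i)) ≤ _ := fun i => by
    have h5 := hg.exp_neg_le hβ hs ⟨e i, h.mem i⟩ (norm_hilbertBasis e i)
    refine le_trans (Real.exp_le_exp.2 (neg_le_neg ?_)) h5
    have h6 := mul_le_mul_of_nonneg_left (H.norm_op_basis_le V h i) hs0
    refine le_trans ?_ h6
    rw [← mul_assoc]
    exact mul_le_mul_of_nonneg_right hsβ (norm_nonneg _)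
  have h7 : HasSum (fun i => ∑' j, Real.exp (-(β * k j)) * ‖inner ℂ (g j) (e i)‖ ^ 2)
      (∑' j, Real.exp (-(β * k j))) := by
    refine h4.congr_fun fun i => tsum_congr fun j => ?_
    simp only [Function.comp, Equiv.prodComm_apply, Prod.swap]
    rw [← inner_conj_symm, RCLike.norm_conj]
  have h8 := Summable.of_nonneg_of_le (fun i => Real.exp_nonneg _) hle h7.summable
  exact ⟨h8, hasSum_le hle h8.hasSum h7⟩

end Hamiltonian

end Perturbed

/-! ### Scalar bounds and the mean $\rho.Y$ -/

lemma exists_rpow_le_exp {c δ : ℝ} (hc : 0 ≤ c) (hδ : 0 < δ) :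
    ∃ K : ℝ, 0 ≤ K ∧ ∀ x : ℝ, 0 ≤ x → x ^ c ≤ K * Real.exp (δ * x) := by
  obtain ⟨n, hn⟩ := exists_nat_ge c
  -- The summand $1$ handles $x\le1$; the other handles $x\ge1$, where $x^c\le x^n$.
  refine ⟨1 + n.factorial / δ ^ n, by positivity, fun x hx => ?_⟩
  have h1 := Real.pow_div_factorial_le_exp (δ * x) (by positivity) n
  have h2 : x ^ n ≤ n.factorial / δ ^ n * Real.exp (δ * x) := by
    rw [mul_pow, div_le_iff₀ (by positivity)] at h1
    rw [div_mul_eq_mul_div, le_div_iff₀ (by positivity)]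
    linarith
  have h3 : 1 ≤ Real.exp (δ * x) := Real.one_le_exp (by positivity)
  rw [add_mul, one_mul]
  rcases le_total x 1 with hx1 | hx1
  · have h4 : x ^ c ≤ 1 := Real.rpow_le_one hx hx1 hc
    have : 0 ≤ x ^ n := by positivity
    linarith
  · have h4 : x ^ c ≤ x ^ (n : ℝ) := Real.rpow_le_rpow_of_exponent_le hx1 hn
    rw [Real.rpow_natCast] at h4
    linarith

/-- Weighted AM–GM with the weights dropped, so that the bound is uniform in $\alpha$. -/
lemma rpow_mul_rpow_le_add {a b α : ℝ} (ha : 0 ≤ a) (hb : 0 ≤ b) (h0 : 0 ≤ α) (h1 : α ≤ 1) :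
    a ^ α * b ^ (1 - α) ≤ a + b := by
  refine (Real.geom_mean_le_arith_mean2_weighted h0 (sub_nonneg.2 h1) ha hb (by ring)).trans ?_
  have h2 : α * a ≤ a := mul_le_of_le_one_left ha h1
  have h3 : (1 - α) * b ≤ b := mul_le_of_le_one_left hb (by linarith)
  linarith

section

variable {E : Type*} [NormedAddCommGroup E] [InnerProductSpace ℂ E]

lemma mem_opComp (A B : E →ₗ.[ℂ] E) (x : E) :
    x ∈ (opComp A B).domain ↔ ∃ h : x ∈ B.domain, B ⟨x, h⟩ ∈ A.domain := by
  constructor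
  · intro h
    obtain ⟨⟨z, hz, rfl⟩, h2⟩ := Submodule.mem_inf.1 h
    exact ⟨h2, hz⟩
  · rintro ⟨h, h1⟩
    exact Submodule.mem_inf.2 ⟨⟨⟨x, h⟩, h1, rfl⟩, h⟩

variable {ι : Type*}

namespace IsDiagonalized

variable {A : E →ₗ.[ℂ] E} {e : HilbertBasis ι ℂ E} {l : ι → ℝ}

/-- The bounded operator `Y A⁻¹`. -/
lemma exists_mul_inv (h : IsDiagonalized A e l) (Y : omegaDirections A) :
    ∃ B : E →L[ℂ] E, ∀ x, B (A x) = Y.1 x := by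
  obtain ⟨-, a, b, hab⟩ := Y.2
  let S : E →ₗ[ℂ] E := Y.1.comp ((bddInv A : E →ₗ[ℂ] E).codRestrict _ h.bddInv_mem)
  have hS : ∀ x, S (A x) = Y.1 x := fun x => congrArg Y.1 (Subtype.ext (h.bddInv_apply x))
  refine ⟨S.mkContinuous (|a| + |b| * ‖bddInv A‖) fun y => ?_, hS⟩
  obtain ⟨x, rfl⟩ := h.surj y
  rw [hS]
  refine (hab x).trans ?_
  have h1 := (bddInv A).le_opNorm (A x)
  rw [h.bddInv_apply] at h1
  have h2 : a * ‖A x‖ ≤ |a| * ‖A x‖ := mul_le_mul_of_nonneg_right (le_abs_self a) (norm_nonneg _)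
  have h3 : b * ‖(x : E)‖ ≤ |b| * (‖bddInv A‖ * ‖A x‖) :=
    mul_le_mul (le_abs_self b) h1 (norm_nonneg _) (abs_nonneg _)
  linarith

lemma norm_apply_basis_le (h : IsDiagonalized A e l) {Y : omegaDirections A} {B : E →L[ℂ] E}
    (hB : ∀ x, B (A x) = Y.1 x) (i : ι) : ‖Y.1 ⟨e i, h.mem i⟩‖ ≤ ‖B‖ * l i := by
  rw [← hB, h.apply]
  refine (B.le_opNorm _).trans_eq ?_
  rw [norm_smul, norm_hilbertBasis, Complex.norm_real, Real.norm_eq_abs, abs_of_pos (h.pos i),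
    mul_one]

/-- The factor $e^{-(1-s)l_i}$ left over from $e^{-sl_i}$ absorbs the power. -/
lemma summable_rpow_mul_exp (h : IsDiagonalized A e l) {s : ℝ} (hs : s < 1)
    (hsum : Summable fun i => Real.exp (-(s * l i))) {c : ℝ} (hc : 0 ≤ c) :
    Summable fun i => l i ^ c * Real.exp (-l i) := by
  obtain ⟨K, hK, hle⟩ := exists_rpow_le_exp hc (sub_pos.2 hs)
  refine Summable.of_nonneg_of_le (fun i => ?_) (fun i => ?_) (hsum.mul_left K)
  · have := (h.pos i).le
    positivity
  · have h1 := mul_le_mul_of_nonneg_right (hle (l i) (h.pos i).le) (Real.exp_nonneg (-l i))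
    rw [mul_assoc, ← Real.exp_add] at h1
    have h2 : -(s * l i) = (1 - s) * l i + -l i := by ring
    rw [h2]
    exact h1

lemma dense_stateMul (h : IsDiagonalized A e l) (ρ : E →L[ℂ] E) (Y : omegaDirections A) :
    Dense ((stateMul ρ (toOp Y)).domain : Set E) :=
  h.dense.mono fun x hx => (mem_opComp_ofBdd ρ (toOp Y) x).2 hx

end IsDiagonalized

variable [CompleteSpace E]

lemma isTraceClass_diag_comp (e : HilbertBasis ι ℂ E) {D : E →L[ℂ] E} {d : ι → ℝ}
    (hD : ∀ i, D (e i) = (d i : ℂ) • e i) (hd0 : ∀ i, 0 ≤ d i) (hd : Summable d)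
    (B : E →L[ℂ] E) : IsTraceClass (D ∘L B) := by
  classical
  refine isTraceClass_of_matrix e (u := fun i => √(d i)) (v := fun i => √(d i)) (p := d) (w := d)
    (fun i => Real.sqrt_nonneg _) (fun i => Real.sqrt_nonneg _) hd hd hd0 hd0 (fun i j => ?_) 1 B _
    fun i x => ?_
  · nlinarith [Real.sq_sqrt (hd0 i), Real.sq_sqrt (hd0 j), sq_nonneg (√(d i) - √(d j)),
      hd0 i, hd0 j]
  · rw [ContinuousLinearMap.comp_apply, inner_diag e hD]
    have h1 : (d i : ℂ) * inner ℂ (e i) (B x) = ((√(d i) * √(d i) : ℝ) : ℂ) *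
        (inner ℂ (e i) ((1 : E →L[ℂ] E) (e i)) * inner ℂ (e i) (B x)) := by
      rw [Real.mul_self_sqrt (hd0 i), one_apply_eq_self, inner_hilbertBasis, if_pos rfl, one_mul]
    rw [h1]
    refine hasSum_single i fun j hj => ?_
    rw [one_apply_eq_self, inner_hilbertBasis, if_neg hj.symm, zero_mul, mul_zero]

namespace IsDiagonalized

variable {A : E →ₗ.[ℂ] E} {e : HilbertBasis ι ℂ E} {l : ι → ℝ}

/-- By symmetry of $Y$, the adjoint of $B=YA^{-1}$ is the bounded extension of $A^{-1}Y$. -/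
lemma inner_adjoint (h : IsDiagonalized A e l) {Y : omegaDirections A} {B : E →L[ℂ] E}
    (hB : ∀ x, B (A x) = Y.1 x) (i : ι) (x : A.domain) :
    inner ℂ (e i) (B.adjoint x) = ((l i)⁻¹ : ℝ) * inner ℂ (e i) (Y.1 x) := by
  have h1 := hB ⟨e i, h.mem i⟩
  have h2 : (l i : ℂ) ≠ 0 := by exact_mod_cast (h.pos i).ne'
  rw [h.apply, map_smul] at h1
  have h3 := Y.2.1 ⟨e i, h.mem i⟩ x
  rw [← h1, inner_smul_left, Complex.conj_ofReal] at h3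
  rw [ContinuousLinearMap.adjoint_inner_right, ← h3, Complex.ofReal_inv, inv_mul_cancel_left₀ h2]

lemma isTraceClass_expNeg (h : IsDiagonalized A e l) (hl : Summable fun i => Real.exp (-l i)) :
    IsTraceClass (expNeg A) :=
  isTraceClass_diag_comp e h.expNeg_basis (fun _ => Real.exp_nonneg _) hl 1

lemma partition_eq (h : IsDiagonalized A e l) (hl : Summable fun i => Real.exp (-l i)) :
    partition A = ∑' i, Real.exp (-l i) := by
  have h1 := (Complex.hasSum_re ((h.isTraceClass_expNeg hl).hasSum e)).tsum_eq
  rw [partition, ← h1]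
  refine tsum_congr fun i => ?_
  rw [h.expNeg_basis, inner_smul_right, inner_self_eq_norm_sq_to_K, norm_hilbertBasis]
  simp [-Complex.ofReal_exp]

lemma partition_pos [Nontrivial E] (h : IsDiagonalized A e l)
    (hl : Summable fun i => Real.exp (-l i)) : 0 < partition A := by
  rw [h.partition_eq hl]
  have : Nonempty ι := by
    by_contra h0
    rw [not_nonempty_iff] at h0
    obtain ⟨x, hx⟩ := exists_ne (0 : E)
    exact hx (ext_hilbertBasis e fun i => isEmptyElim i)
  exact hl.tsum_pos (fun i => Real.exp_nonneg _) (Classical.arbitrary ι) (Real.exp_pos _)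

lemma state_basis (h : IsDiagonalized A e l) (i : ι) :
    state A (e i) = (((partition A)⁻¹ * Real.exp (-l i) : ℝ) : ℂ) • e i := by
  rw [state, smul_apply, h.expNeg_basis, ← Complex.coe_smul, smul_smul, Complex.ofReal_mul]

lemma state_nonneg (hZ : 0 ≤ partition A) : 0 ≤ state A :=
  smul_nonneg (inv_nonneg.2 hZ) (expNeg_nonneg A)

variable [Nontrivial E]

lemma exists_ext_stateMul (h : IsDiagonalized A e l) {s : ℝ} (hs : s < 1)
    (hsum : Summable fun i => Real.exp (-(s * l i))) (Y : omegaDirections A) :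
    ∃ T : E →L[ℂ] E, IsTraceClass T ∧ ∀ x : A.domain, T x = state A (Y.1 x) := by
  obtain ⟨B, hB⟩ := h.exists_mul_inv Y
  have h1 := h.summable_rpow_mul_exp hs hsum zero_le_one
  simp only [Real.rpow_one] at h1
  have h2 := h1.mul_left (partition A)⁻¹
  have hl : Summable fun i => Real.exp (-l i) := by
    simpa using h.summable_rpow_mul_exp hs hsum le_rfl
  have hZ := h.partition_pos hl
  have h3 : ∀ i, 0 ≤ (partition A)⁻¹ * (l i * Real.exp (-l i)) := fun i => by
    have := (h.pos i).le
    positivity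
  -- Here $D=\rho A$, so that $\rho Y=(\rho A)(A^{-1}Y)$ extends to $DB^*$.
  obtain ⟨D, hD⟩ := exists_diag e (fun i => (partition A)⁻¹ * (l i * Real.exp (-l i)))
    (∑' i, (partition A)⁻¹ * (l i * Real.exp (-l i))) fun i => by
      rw [abs_of_nonneg (h3 i)]
      exact h2.le_tsum i fun j _ => h3 j
  refine ⟨D ∘L B.adjoint, isTraceClass_diag_comp e hD h3 h2 _, fun x => ?_⟩
  refine ext_hilbertBasis e fun i => ?_
  rw [ContinuousLinearMap.comp_apply, inner_diag e hD, h.inner_adjoint hB,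
    inner_diag e h.state_basis, ← mul_assoc, ← Complex.ofReal_mul]
  congr 2
  have := (h.pos i).ne'
  field_simp

lemma hasTraceClassExt_stateMul (h : IsDiagonalized A e l) {s : ℝ} (hs : s < 1)
    (hsum : Summable fun i => Real.exp (-(s * l i))) (Y : omegaDirections A) :
    HasTraceClassExt (stateMul (state A) (toOp Y)) := by
  obtain ⟨T, hT, hx⟩ := h.exists_ext_stateMul hs hsum Y
  exact ⟨h.dense_stateMul _ Y, T, fun x => hx ⟨x, (mem_opComp_ofBdd _ (toOp Y) x).1 x.2⟩, hT⟩

lemma hasSum_mean (h : IsDiagonalized A e l) {s : ℝ} (hs : s < 1)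
    (hsum : Summable fun i => Real.exp (-(s * l i))) (Y : omegaDirections A) :
    HasSum (fun i => (((partition A)⁻¹ * Real.exp (-l i) : ℝ) : ℂ) *
      inner ℂ (e i) (Y.1 ⟨e i, h.mem i⟩)) (mean (state A) (toOp Y)) := by
  obtain ⟨T, hT, hx⟩ := h.exists_ext_stateMul hs hsum Y
  have h1 : bddExt (stateMul (state A) (toOp Y)) = T :=
    bddExt_eq (h.dense_stateMul _ Y) fun x => hx ⟨x, (mem_opComp_ofBdd _ (toOp Y) x).1 x.2⟩
  rw [mean, traceExt, h1]
  refine (hT.hasSum e).congr_fun fun i => ?_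
  rw [hx ⟨e i, h.mem i⟩, inner_diag e h.state_basis]

end IsDiagonalized

end

/-! ### Bounding the mean by $\|R_XY\|$ -/

section

variable {E : Type*} [NormedAddCommGroup E] [InnerProductSpace ℂ E]
  {ι : Type*}

namespace IsDiagonalized

variable {A : E →ₗ.[ℂ] E} {e : HilbertBasis ι ℂ E} {l : ι → ℝ}

lemma lowerBound_basis (h : IsDiagonalized A e l) {c m : ℝ} (hm : LowerBound m (addConst A c))
    (i : ι) : m ≤ l i + c := by
  have h1 := hm ⟨e i, h.mem i⟩
  have h2 : addConst A c ⟨e i, h.mem i⟩ = A ⟨e i, h.mem i⟩ + (c : ℂ) • e i := rfl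
  rw [h2, h.apply, ← add_smul, inner_smul_right, inner_self_eq_norm_sq_to_K,
    norm_hilbertBasis] at h1
  simpa using h1

variable [CompleteSpace E]

/-- The bounded extension of `(A + c)⁻¹ Y`. -/
lemma exists_ext_addConst (h : IsDiagonalized A e l) {c m : ℝ} (hm0 : 0 < m)
    (hm : LowerBound m (addConst A c)) (Y : omegaDirections A) :
    ∃ G : E →L[ℂ] E, omegaSize (bddInv (addConst A c)) (toOp Y) = ‖G‖ ∧
      ∀ i, inner ℂ (e i) (Y.1 ⟨e i, h.mem i⟩) = ((l i + c : ℝ) : ℂ) * inner ℂ (e i) (G (e i)) := by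
  obtain ⟨B, hB⟩ := h.exists_mul_inv Y
  have hlc : ∀ i, 0 < l i + c := fun i => hm0.trans_le (h.lowerBound_basis hm i)
  -- $D=A(A+c)^{-1}$ converts $A^{-1}$ into $(A+c)^{-1}$; it is bounded because
  -- $l_i/(l_i+c)=1-c/(l_i+c)$ and $l_i+c\ge m$.
  obtain ⟨D, hD⟩ := exists_diag e (fun i => l i / (l i + c)) (1 + |c| / m) fun i => by
    have h1 : l i / (l i + c) = 1 + -c / (l i + c) := by
      have := (hlc i).ne'
      field_simp
      ring
    rw [h1]
    refine (abs_add_le _ _).trans ?_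
    rw [abs_one, abs_div, abs_neg, abs_of_pos (hlc i)]
    gcongr
    exact h.lowerBound_basis hm i
  have hR : ∀ i x, inner ℂ (e i) ((bddInv A ∘L D) x) =
      (((l i + c)⁻¹ : ℝ) : ℂ) * inner ℂ (e i) x := fun i x => by
    rw [ContinuousLinearMap.comp_apply, inner_diag e h.bddInv_basis, inner_diag e hD, ← mul_assoc,
      ← Complex.ofReal_mul]
    congr 2
    have := (h.pos i).ne'
    field_simp
  have hc : ∀ (x : A.domain) i, inner ℂ (e i) (addConst A c x) =
      ((l i + c : ℝ) : ℂ) * inner ℂ (e i) (x : E) := fun x i => by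
    have h2 : addConst A c x = A x + (c : ℂ) • (x : E) := rfl
    rw [h2, inner_add_right, h.inner_apply, inner_smul_right, Complex.ofReal_add, add_mul]
  have hinv : bddInv (addConst A c) = bddInv A ∘L D := by
    refine bddInv_eq (fun y => ?_) fun x => ?_
    · refine ⟨⟨(bddInv A ∘L D) y, h.bddInv_mem _⟩, ext_hilbertBasis e fun i => ?_⟩
      refine (hc _ i).trans ?_
      change _ * inner ℂ (e i) ((bddInv A ∘L D) y) = _
      rw [hR, ← mul_assoc, ← Complex.ofReal_mul, mul_inv_cancel₀ (hlc i).ne', Complex.ofReal_one,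
        one_mul]
    · refine ext_hilbertBasis e fun i => ?_
      rw [hR]
      refine (congrArg _ (hc x i)).trans ?_
      rw [← mul_assoc, ← Complex.ofReal_mul, inv_mul_cancel₀ (hlc i).ne', Complex.ofReal_one,
        one_mul]
  have hG : ∀ (x : A.domain) i, inner ℂ (e i) ((D ∘L B.adjoint) x) =
      (((l i + c)⁻¹ : ℝ) : ℂ) * inner ℂ (e i) (Y.1 x) := fun x i => by
    rw [ContinuousLinearMap.comp_apply, inner_diag e hD, h.inner_adjoint hB, ← mul_assoc,
      ← Complex.ofReal_mul]
    congr 2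
    have := (h.pos i).ne'
    field_simp
  refine ⟨D ∘L B.adjoint, ?_, fun i => ?_⟩
  · rw [omegaSize, hinv]
    congr 1
    refine bddExt_eq (h.dense.mono fun x hx => (mem_opComp_ofBdd _ (toOp Y) x).2 hx) fun x => ?_
    refine ext_hilbertBasis e fun i => ?_
    rw [opComp_ofBdd_apply, hR]
    exact hG ⟨x, (mem_opComp_ofBdd _ (toOp Y) x).1 x.2⟩ i
  · rw [hG ⟨e i, h.mem i⟩ i, ← mul_assoc, ← Complex.ofReal_mul, mul_inv_cancel₀ (hlc i).ne',
      Complex.ofReal_one, one_mul]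

variable [Nontrivial E]

lemma exists_norm_mean_le (h : IsDiagonalized A e l) {s : ℝ} (hs : s < 1)
    (hsum : Summable fun i => Real.exp (-(s * l i))) {c m : ℝ} (hm0 : 0 < m)
    (hm : LowerBound m (addConst A c)) :
    ∃ C : ℝ, ∀ Y : omegaDirections A, ‖mean (state A) (toOp Y)‖ ≤
      C * omegaSize (bddInv (addConst A c)) (toOp Y) := by
  have hl : Summable fun i => Real.exp (-l i) := by
    simpa using h.summable_rpow_mul_exp hs hsum le_rfl
  have hl1 : Summable fun i => l i * Real.exp (-l i) := by
    simpa using h.summable_rpow_mul_exp hs hsum zero_le_one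
  have hZ := h.partition_pos hl
  have hC : Summable fun i => (partition A)⁻¹ * Real.exp (-l i) * (l i + c) := by
    refine ((hl1.add (hl.mul_left c)).mul_left (partition A)⁻¹).congr fun i => ?_
    ring
  refine ⟨∑' i, (partition A)⁻¹ * Real.exp (-l i) * (l i + c), fun Y => ?_⟩
  obtain ⟨G, hG, hY⟩ := h.exists_ext_addConst hm0 hm Y
  rw [hG, ← (h.hasSum_mean hs hsum Y).tsum_eq]
  refine tsum_of_norm_bounded (hC.hasSum.mul_right ‖G‖) fun i => ?_
  have hlc : 0 < l i + c := hm0.trans_le (h.lowerBound_basis hm i)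
  rw [hY, ← mul_assoc, ← Complex.ofReal_mul, norm_mul, Complex.norm_real, Real.norm_eq_abs,
    abs_of_nonneg (by positivity)]
  refine mul_le_mul_of_nonneg_left ?_ (by positivity)
  refine (norm_inner_le_norm _ _).trans ?_
  rw [norm_hilbertBasis, one_mul]
  exact (G.le_opNorm _).trans_eq (by rw [norm_hilbertBasis, mul_one])

end IsDiagonalized

end

/-! ### Finiteness of the BKM metric -/

section

variable {E : Type*} [NormedAddCommGroup E] [InnerProductSpace ℂ E] {ι : Type*}

lemma summable_weighted_matrix (e : HilbertBasis ι ℂ E) {w : ι → ℝ} (hw : ∀ i, 0 ≤ w i)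
    {y : ι → E} (hsym : ∀ i j, ‖inner ℂ (e j) (y i)‖ = ‖inner ℂ (e i) (y j)‖)
    (h : Summable fun i => w i * ‖y i‖ ^ 2) :
    Summable fun q : ι × ι => (w q.1 + w q.2) * ‖inner ℂ (e q.2) (y q.1)‖ ^ 2 := by
  have h1 := summable_prod_norm_inner_sq e hw h
  refine (h1.add ((Equiv.prodComm ι ι).summable_iff.2 h1)).congr fun q => ?_
  simp only [Function.comp, Equiv.prodComm_apply, Prod.swap]
  rw [hsym q.2 q.1, add_mul]

variable [CompleteSpace E] [Nontrivial E]

namespace IsDiagonalized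

variable {A : E →ₗ.[ℂ] E} {e : HilbertBasis ι ℂ E} {l : ι → ℝ}

lemma exists_ext_bkmOp (h : IsDiagonalized A e l) {s : ℝ} (hs : s < 1)
    (hsum : Summable fun i => Real.exp (-(s * l i))) (Y Z : omegaDirections A) {α : ℝ}
    (hα : α ∈ Set.Ioo (0 : ℝ) 1) :
    ∃ T : E →L[ℂ] E, IsTraceClass T ∧ ∀ x : A.domain,
      ∃ hx : (state A ^ (1 - α)) (Z.1 x) ∈ A.domain, T x = (state A ^ α) (Y.1 ⟨_, hx⟩) := by
  obtain ⟨hα0, hα1⟩ := hα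
  have hα1' : 0 < 1 - α := sub_pos.2 hα1
  have hl : Summable fun i => Real.exp (-l i) := by
    simpa using h.summable_rpow_mul_exp hs hsum le_rfl
  have hZ := h.partition_pos hl
  have hρ := state_nonneg hZ.le
  set p : ι → ℝ := fun i => (partition A)⁻¹ * Real.exp (-l i) with hp
  have hp0 : ∀ i, 0 ≤ p i := fun i => by positivity
  have hps : Summable p := hl.mul_left _
  -- The exponent is chosen so that $b_i^{1-\alpha}=l_i^2p_i^{1-\alpha}$, the eigenvalue of
  -- $A\rho^{1-\alpha}A$, while $b$ itself stays summable.
  set b : ι → ℝ := fun i => l i ^ (2 / (1 - α)) * p i with hb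
  have hb0 : ∀ i, 0 ≤ b i := fun i => mul_nonneg (Real.rpow_nonneg (h.pos i).le _) (hp0 i)
  have hbs : Summable b := by
    refine ((h.summable_rpow_mul_exp hs hsum (c := 2 / (1 - α)) (by positivity)).mul_left
      (partition A)⁻¹).congr fun i => ?_
    simp only [hb, hp]
    ring
  have hbv : ∀ i, b i ^ (1 - α) = l i ^ 2 * p i ^ (1 - α) := fun i => by
    rw [hb, Real.mul_rpow (Real.rpow_nonneg (h.pos i).le _) (hp0 i), ← Real.rpow_mul (h.pos i).le,
      div_mul_cancel₀ _ hα1'.ne', Real.rpow_ofNat]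
  obtain ⟨BY, hBY⟩ := h.exists_mul_inv Y
  obtain ⟨BZ, hBZ⟩ := h.exists_mul_inv Z
  obtain ⟨D, hD⟩ := exists_diag e (fun i => b i ^ (1 - α)) ((∑' i, b i) ^ (1 - α)) fun i => by
    rw [abs_of_nonneg (Real.rpow_nonneg (hb0 i) _)]
    exact Real.rpow_le_rpow (hb0 i) (hbs.le_tsum i fun j _ => hb0 j) hα1'.le
  have hρα : ∀ {γ : ℝ}, 0 ≤ γ → ∀ i, (state A ^ γ) (e i) = ((p i ^ γ : ℝ) : ℂ) • e i :=
    fun hγ i => rpow_apply_eigenvector hρ hγ (h.state_basis i) (ne_zero_basis e i)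
  -- This also puts $\rho^{1-\alpha}Zx$ in the domain of $A$, so $Y$ may be applied to it.
  have hR : ∀ x : A.domain, bddInv A (D (BZ.adjoint x)) = (state A ^ (1 - α)) (Z.1 x) := fun x => by
    refine ext_hilbertBasis e fun i => ?_
    rw [inner_diag e h.bddInv_basis, inner_diag e hD, h.inner_adjoint hBZ,
      inner_diag e (hρα hα1'.le), hbv, ← mul_assoc, ← mul_assoc, ← Complex.ofReal_mul,
      ← Complex.ofReal_mul]
    congr 2
    have := (h.pos i).ne'
    field_simp
  refine ⟨(state A ^ α) ∘L BY ∘L D ∘L BZ.adjoint, ?_, fun x => ?_⟩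
  · refine isTraceClass_of_matrix e (u := fun i => p i ^ α) (v := fun i => b i ^ (1 - α))
      (fun i => Real.rpow_nonneg (hp0 i) _) (fun i => Real.rpow_nonneg (hb0 i) _) hps hbs hp0 hb0
      (fun i j => rpow_mul_rpow_le_add (hp0 i) (hb0 j) hα0.le hα1.le) BY BZ.adjoint _ fun i x => ?_
    simp only [ContinuousLinearMap.comp_apply]
    rw [inner_diag e (hρα hα0.le)]
    have h1 := (e.hasSum_inner_mul_inner (BY.adjoint (e i)) (D (BZ.adjoint x))).mul_left
      ((p i ^ α : ℝ) : ℂ)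
    rw [ContinuousLinearMap.adjoint_inner_left] at h1
    refine h1.congr_fun fun j => ?_
    rw [ContinuousLinearMap.adjoint_inner_left, inner_diag e hD]
    push_cast
    ring
  · refine ⟨hR x ▸ h.bddInv_mem _, ?_⟩
    simp only [ContinuousLinearMap.comp_apply]
    congr 1
    obtain ⟨z, hz⟩ := h.surj (D (BZ.adjoint x))
    have h2 := h.bddInv_apply z
    rw [hz, hR] at h2
    exact (congrArg BY hz.symm).trans ((hBY z).trans (congrArg Y.1 (Subtype.ext h2.symm)))

lemma bkmFinite (h : IsDiagonalized A e l) {s : ℝ} (hs : s < 1)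
    (hsum : Summable fun i => Real.exp (-(s * l i))) (Y Z : omegaDirections A) :
    BKMFinite (state A) (toOp Y) (toOp Z) := by
  have hl : Summable fun i => Real.exp (-l i) := by
    simpa using h.summable_rpow_mul_exp hs hsum le_rfl
  have hZ := h.partition_pos hl
  have hρ := state_nonneg hZ.le
  have hext : ∀ α ∈ Set.Ioo (0 : ℝ) 1, ∃ T : E →L[ℂ] E, IsTraceClass T ∧
      Dense ((bkmOp (state A) (toOp Y) (toOp Z) α).domain : Set E) ∧
      (∀ x : (bkmOp (state A) (toOp Y) (toOp Z) α).domain,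
        T x = bkmOp (state A) (toOp Y) (toOp Z) α x) ∧
      ∀ i, inner ℂ (e i) (T (e i)) = inner ℂ (e i) ((state A ^ α) (e i)) *
        inner ℂ (Y.1 ⟨e i, h.mem i⟩) ((state A ^ (1 - α)) (Z.1 ⟨e i, h.mem i⟩)) := by
    intro α hα
    obtain ⟨T, hT, hx⟩ := h.exists_ext_bkmOp hs hsum Y Z hα
    have hmem : ∀ x, x ∈ (bkmOp (state A) (toOp Y) (toOp Z) α).domain ↔ x ∈ A.domain := fun x => by
      rw [bkmOp, mem_opComp_ofBdd, mem_opComp]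
      refine ⟨fun ⟨h1, _⟩ => (mem_opComp_ofBdd _ (toOp Z) x).1 h1,
        fun h1 => ⟨(mem_opComp_ofBdd _ (toOp Z) x).2 h1, (hx ⟨x, h1⟩).1⟩⟩
    refine ⟨T, hT, h.dense.mono fun x hx' => (hmem x).2 hx', fun x => ?_, fun i => ?_⟩
    · obtain ⟨h1, h2⟩ := hx ⟨x, (hmem x).1 x.2⟩
      exact h2
    · obtain ⟨h1, h2⟩ := hx ⟨e i, h.mem i⟩
      have h3 := rpow_apply_eigenvector hρ hα.1.le (h.state_basis i) (ne_zero_basis e i)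
      have h4 := Y.2.1 ⟨e i, h.mem i⟩ ⟨_, h1⟩
      rw [h2, ← inner_apply_of_isSelfAdjoint CFC.rpow_nonneg.isSelfAdjoint, h3, inner_smul_left,
        inner_smul_right, inner_self_eq_norm_sq_to_K, norm_hilbertBasis, Complex.conj_ofReal,
        ← h4]
      simp
  refine ⟨fun α hα => ?_, ?_⟩
  · obtain ⟨T, hT, hd, hx, -⟩ := hext α hα
    exact ⟨hd, T, hx, hT⟩
  set p : ι → ℝ := fun i => (partition A)⁻¹ * Real.exp (-l i) with hp
  have hp0 : ∀ i, 0 < p i := fun i => mul_pos (inv_pos.2 hZ) (Real.exp_pos _)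
  have hmat : ∀ Y : omegaDirections A, Summable fun q : ι × ι =>
      (p q.1 + p q.2) * ‖inner ℂ (e q.2) (Y.1 ⟨e q.1, h.mem q.1⟩)‖ ^ 2 := fun Y => by
    obtain ⟨B, hB⟩ := h.exists_mul_inv Y
    refine summable_weighted_matrix e (y := fun i => Y.1 ⟨e i, h.mem i⟩) (fun i => (hp0 i).le)
      (fun i j => ?_) ?_
    · rw [← Y.2.1 ⟨e j, h.mem j⟩ ⟨e i, h.mem i⟩, ← inner_conj_symm, RCLike.norm_conj]
    · have h1 : Summable fun i => l i ^ 2 * Real.exp (-l i) := by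
        simpa using h.summable_rpow_mul_exp hs hsum zero_le_two
      refine Summable.of_nonneg_of_le (fun i => mul_nonneg (hp0 i).le (sq_nonneg _)) (fun i => ?_)
        (h1.mul_left (‖B‖ ^ 2 * (partition A)⁻¹))
      have h2 := pow_le_pow_left₀ (norm_nonneg _) (h.norm_apply_basis_le hB i) 2
      refine (mul_le_mul_of_nonneg_left h2 (hp0 i).le).trans_eq ?_
      simp only [hp]
      ring
  -- The trace expanded in matrix elements. The dominating series does not depend on $\alpha$, so
  -- the sum is continuous on the closed interval $[0,1]$, hence integrable.
  let F : ι × ι → ℝ → ℂ := fun q α => ((p q.1 ^ α * p q.2 ^ (1 - α) : ℝ) : ℂ) *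
    (inner ℂ (Y.1 ⟨e q.1, h.mem q.1⟩) (e q.2) * inner ℂ (e q.2) (Z.1 ⟨e q.1, h.mem q.1⟩))
  have hFle : ∀ q, ∀ α ∈ Set.Icc (0 : ℝ) 1, ‖F q α‖ ≤
      (p q.1 + p q.2) * ‖inner ℂ (e q.2) (Y.1 ⟨e q.1, h.mem q.1⟩)‖ ^ 2 +
      (p q.1 + p q.2) * ‖inner ℂ (e q.2) (Z.1 ⟨e q.1, h.mem q.1⟩)‖ ^ 2 := fun q α hα => by
    have h1 := rpow_mul_rpow_le_add (hp0 q.1).le (hp0 q.2).le hα.1 hα.2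
    simp only [F]
    rw [norm_mul, norm_mul, Complex.norm_real, Real.norm_eq_abs,
      abs_of_nonneg (mul_nonneg (Real.rpow_nonneg (hp0 _).le _) (Real.rpow_nonneg (hp0 _).le _)),
      ← inner_conj_symm (Y.1 _), RCLike.norm_conj, ← mul_add]
    set a := ‖inner ℂ (e q.2) (Y.1 ⟨e q.1, h.mem q.1⟩)‖
    set c := ‖inner ℂ (e q.2) (Z.1 ⟨e q.1, h.mem q.1⟩)‖
    have h6 : a * c ≤ a ^ 2 + c ^ 2 := by nlinarith [sq_nonneg (a - c), sq_nonneg a, sq_nonneg c]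
    exact mul_le_mul h1 h6 (mul_nonneg (norm_nonneg _) (norm_nonneg _))
      (add_nonneg (hp0 _).le (hp0 _).le)
  have hcont : ContinuousOn (fun α => ∑' q, F q α) (Set.Icc 0 1) := by
    refine continuousOn_tsum (fun q => ?_) ((hmat Y).add (hmat Z)) hFle
    have h1 : Continuous fun α : ℝ => p q.1 ^ α * p q.2 ^ (1 - α) :=
      (Real.continuous_const_rpow (hp0 _).ne').mul
        ((Real.continuous_const_rpow (hp0 _).ne').comp (continuous_const.sub continuous_id))
    exact ((Complex.continuous_ofReal.comp h1).mul continuous_const).continuousOn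
  have hint := hcont.intervalIntegrable_of_Icc (μ := MeasureTheory.volume) zero_le_one
  -- Agreement with the trace is needed only on the open interval; the endpoints do not affect
  -- integrability.
  refine hint.congr_uIoo fun α hα => ?_
  rw [Set.uIoo_of_le zero_le_one] at hα
  obtain ⟨T, hT, hd, hx, hin⟩ := hext α hα
  rw [bkmIntegrand, traceExt, bddExt_eq hd hx]
  have hFs : Summable fun q => F q α := Summable.of_norm_bounded ((hmat Y).add (hmat Z))
    fun q => hFle q α ⟨hα.1.le, hα.2.le⟩
  have h5 := hFs.hasSum.prod_fiberwise (g := fun i => inner ℂ (e i) (T (e i))) fun i => ?_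
  · exact h5.unique (hT.hasSum e)
  · have h6 := fun γ hγ => rpow_apply_eigenvector (α := γ) hρ hγ (h.state_basis i)
      (ne_zero_basis e i)
    have h7 := fun j => rpow_apply_eigenvector (α := 1 - α) hρ (sub_nonneg.2 hα.2.le)
      (h.state_basis j) (ne_zero_basis e j)
    rw [hin, h6 α hα.1.le, inner_smul_right, inner_self_eq_norm_sq_to_K, norm_hilbertBasis]
    have h8 := (e.hasSum_inner_mul_inner (Y.1 ⟨e i, h.mem i⟩)
      ((state A ^ (1 - α)) (Z.1 ⟨e i, h.mem i⟩))).mul_left ((p i ^ α : ℝ) : ℂ)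
    have h9 : (RCLike.ofReal (1 : ℝ) : ℂ) ^ 2 = 1 := by simp
    rw [h9, mul_one]
    refine h8.congr_fun fun j => ?_
    rw [inner_diag e h7]
    simp only [F]
    push_cast
    ring

end IsDiagonalized

end

/-! ### Second order remainder of $\operatorname{Tr}e^{-A}$ -/

/-- Convexity gives the lower bound. The upper one is symmetric in the weights $e^{-m}$ and
$e^{-l}$, so that each weight can be paired with its own eigenbasis. -/
lemma exp_neg_taylor (l m : ℝ) :
    0 ≤ Real.exp (-m) - Real.exp (-l) + Real.exp (-l) * (m - l) ∧
    Real.exp (-m) - Real.exp (-l) + Real.exp (-l) * (m - l) ≤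
      (Real.exp (-m) + Real.exp (-l)) * (m - l) ^ 2 := by
  obtain ⟨t, rfl⟩ : ∃ t, m = l + t := ⟨m - l, by ring⟩
  have h1 : Real.exp (-(l + t)) = Real.exp (-l) * Real.exp (-t) := by
    rw [← Real.exp_add]
    ring_nf
  have h2 := Real.add_one_le_exp (-t)
  have h3 : Real.exp (-t) * (1 + t) ≤ 1 := by
    have h4 := mul_le_mul_of_nonneg_left (Real.add_one_le_exp t) (Real.exp_nonneg (-t))
    rw [← Real.exp_add, neg_add_cancel, Real.exp_zero] at h4
    linarith
  have ha := Real.exp_pos (-t)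
  have hl := Real.exp_pos (-l)
  rw [h1, add_sub_cancel_left]
  set a := Real.exp (-t)
  set b := Real.exp (-l)
  have h5 : 0 ≤ a - 1 + t := by linarith
  have h6 : a - 1 + t ≤ (a + 1) * t ^ 2 := by
    have h7 : a - 1 + t ≤ t * (1 - a) := by linarith
    refine h7.trans ?_
    rcases le_total 0 t with ht | ht
    · nlinarith [mul_nonneg ha.le (sq_nonneg t)]
    · nlinarith [mul_nonneg (neg_nonneg.2 ht) (sub_nonneg.2 h3), sq_nonneg t]
  constructor
  · nlinarith [mul_nonneg hl.le h5]
  · nlinarith [mul_le_mul_of_nonneg_left h6 hl.le]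

section

variable {ι κ : Type*}

lemma summable_diag_and_le {E : Type*} [NormedAddCommGroup E] {l : ι → ℝ} (hl : ∀ i, 0 ≤ l i)
    {δ s K : ℝ}
    (hK : ∀ x : ℝ, 0 ≤ x → x ^ (2 : ℝ) ≤ K * Real.exp ((1 - s) * x))
    (hs : Summable fun i => Real.exp (-(s * l i))) {v : ι → E} (hv : ∀ i, ‖v i‖ ≤ δ * l i) :
    (Summable fun i => Real.exp (-l i) * ‖v i‖ ^ 2) ∧
      ∑' i, Real.exp (-l i) * ‖v i‖ ^ 2 ≤ δ ^ 2 * K * ∑' i, Real.exp (-(s * l i)) := by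
  have hle : ∀ i, Real.exp (-l i) * ‖v i‖ ^ 2 ≤ δ ^ 2 * K * Real.exp (-(s * l i)) := fun i => by
    have h1 := pow_le_pow_left₀ (norm_nonneg _) (hv i) 2
    have h2 := hK (l i) (hl i)
    rw [Real.rpow_two] at h2
    have h3 : -(s * l i) = (1 - s) * l i + -l i := by ring
    rw [h3, Real.exp_add]
    calc _ ≤ Real.exp (-l i) * (δ * l i) ^ 2 := mul_le_mul_of_nonneg_left h1 (Real.exp_nonneg _)
      _ = Real.exp (-l i) * δ ^ 2 * l i ^ 2 := by ring
      _ ≤ Real.exp (-l i) * δ ^ 2 * (K * Real.exp ((1 - s) * l i)) :=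
        mul_le_mul_of_nonneg_left h2 (by positivity)
      _ = _ := by ring
  have h4 := Summable.of_nonneg_of_le (fun i => by positivity) hle (hs.mul_left (δ ^ 2 * K))
  exact ⟨h4, hasSum_le hle h4.hasSum (hs.hasSum.mul_left _)⟩

variable {E : Type*} [NormedAddCommGroup E] [InnerProductSpace ℂ E]

/-- The second order remainder of `A ↦ Tr e^{-A}` in terms of the eigenvalues `l` of `A`, those
`m` of the perturbed operator, and the images `v`, `w` of the eigenvectors under the perturbation. -/
lemma abs_sum_exp_sub_le {e : HilbertBasis ι ℂ E} {f : HilbertBasis κ ℂ E}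
    {l : ι → ℝ} {m : κ → ℝ}
    {v : ι → E} {w : κ → E}
    (hvw : ∀ i j, inner ℂ (f j) (v i) = inner ℂ (w j) (e i))
    (hv : ∀ i j, inner ℂ (f j) (v i) = ((m j - l i : ℝ) : ℂ) * inner ℂ (f j) (e i))
    (hl : Summable fun i => Real.exp (-l i)) (hm : Summable fun j => Real.exp (-m j))
    (hvs : Summable fun i => Real.exp (-l i) * ‖v i‖ ^ 2)
    (hws : Summable fun j => Real.exp (-m j) * ‖w j‖ ^ 2) :
    |∑' j, Real.exp (-m j) - ∑' i, Real.exp (-l i) +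
      ∑' i, Real.exp (-l i) * (inner ℂ (e i) (v i)).re| ≤
      ∑' j, Real.exp (-m j) * ‖w j‖ ^ 2 + ∑' i, Real.exp (-l i) * ‖v i‖ ^ 2 := by
  have hsw : ∀ (x y : E), ‖inner ℂ x y‖ = ‖inner ℂ y x‖ := fun x y => norm_inner_symm x y
  have h1 : HasSum (fun q : ι × κ => Real.exp (-l q.1) * ‖inner ℂ (f q.2) (e q.1)‖ ^ 2)
      (∑' i, Real.exp (-l i)) := by
    refine hasSum_prod_norm_inner_sq f (w := fun i => Real.exp (-l i)) (v := fun i => e i)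
      (fun i => Real.exp_nonneg _) ?_
    simpa only [norm_hilbertBasis, one_pow, mul_one] using hl.hasSum
  have h2 : HasSum (fun q : ι × κ => Real.exp (-m q.2) * ‖inner ℂ (f q.2) (e q.1)‖ ^ 2)
      (∑' j, Real.exp (-m j)) := by
    have h3 : HasSum (fun j => Real.exp (-m j) * ‖f j‖ ^ 2) (∑' j, Real.exp (-m j)) := by
      simpa only [norm_hilbertBasis, one_pow, mul_one] using hm.hasSum
    have h4 := hasSum_prod_norm_inner_sq e (w := fun j => Real.exp (-m j)) (v := fun j => f j)
      (fun j => Real.exp_nonneg _) h3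
    refine ((Equiv.prodComm ι κ).hasSum_iff.2 h4).congr_fun fun q => ?_
    simp only [Function.comp, Equiv.prodComm_apply, Prod.swap]
    rw [hsw]
  have h5 := hasSum_prod_norm_inner_sq f (w := fun i => Real.exp (-l i)) (v := v)
    (fun i => Real.exp_nonneg _) hvs.hasSum
  have h6 : HasSum (fun q : ι × κ => Real.exp (-m q.2) * ‖inner ℂ (f q.2) (v q.1)‖ ^ 2)
      (∑' j, Real.exp (-m j) * ‖w j‖ ^ 2) := by
    have h4 := hasSum_prod_norm_inner_sq e (w := fun j => Real.exp (-m j)) (v := w)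
      (fun j => Real.exp_nonneg _) hws.hasSum
    refine ((Equiv.prodComm ι κ).hasSum_iff.2 h4).congr_fun fun q => ?_
    simp only [Function.comp, Equiv.prodComm_apply, Prod.swap]
    rw [hvw, hsw]
  have h7 : HasSum (fun q : ι × κ => Real.exp (-l q.1) *
      ((m q.2 - l q.1) * ‖inner ℂ (f q.2) (e q.1)‖ ^ 2))
      (∑' i, Real.exp (-l i) * (inner ℂ (e i) (v i)).re) := by
    have h8 : Summable fun q : ι × κ => Real.exp (-l q.1) *
        ((m q.2 - l q.1) * ‖inner ℂ (f q.2) (e q.1)‖ ^ 2) := by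
      refine Summable.of_norm_bounded (h1.add h5).summable fun q => ?_
      rw [hv, norm_mul, norm_mul, norm_mul, ← mul_add, Complex.norm_real, norm_pow, norm_norm,
        Real.norm_eq_abs, Real.norm_eq_abs, abs_of_nonneg (Real.exp_nonneg _)]
      refine mul_le_mul_of_nonneg_left ?_ (Real.exp_nonneg _)
      set c := ‖inner ℂ (f q.2) (e q.1)‖
      set d := |m q.2 - l q.1|
      nlinarith [sq_nonneg (c - d * c), sq_nonneg c, sq_nonneg (d * c)]
    have h9 := h8.hasSum.prod_fiberwise fun i => by
      have h10 := (Complex.hasSum_re (f.hasSum_inner_mul_inner (e i) (v i))).mul_left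
        (Real.exp (-l i))
      refine h10.congr_fun (g := fun j => Real.exp (-l i) *
        ((m j - l i) * ‖inner ℂ (f j) (e i)‖ ^ 2)) fun j => ?_
      congr 1
      rw [hv, mul_left_comm, ← inner_conj_symm (e i), Complex.conj_mul', ← Complex.ofReal_pow,
        ← Complex.ofReal_mul, Complex.ofReal_re]
    rw [h9.tsum_eq]
    exact h8.hasSum
  -- All three traces are now sums over pairs with the common weight $|\langle f_j,e_i\rangle|^2$,
  -- so the scalar Taylor estimate applies termwise; `hv` turns $(m_j-l_i)^2|\langle
  -- f_j,e_i\rangle|^2$ into $|\langle f_j,v_i\rangle|^2$.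
  have h11 := (h2.sub h1).add h7
  have h12 : ∀ q : ι × κ, Real.exp (-m q.2) * ‖inner ℂ (f q.2) (e q.1)‖ ^ 2 -
      Real.exp (-l q.1) * ‖inner ℂ (f q.2) (e q.1)‖ ^ 2 + Real.exp (-l q.1) *
      ((m q.2 - l q.1) * ‖inner ℂ (f q.2) (e q.1)‖ ^ 2) =
      (Real.exp (-m q.2) - Real.exp (-l q.1) + Real.exp (-l q.1) * (m q.2 - l q.1)) *
      ‖inner ℂ (f q.2) (e q.1)‖ ^ 2 := fun q => by ring
  have h13 : 0 ≤ ∑' j, Real.exp (-m j) - ∑' i, Real.exp (-l i) +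
      ∑' i, Real.exp (-l i) * (inner ℂ (e i) (v i)).re := by
    refine h11.nonneg fun q => ?_
    rw [h12]
    exact mul_nonneg (exp_neg_taylor _ _).1 (sq_nonneg _)
  rw [abs_of_nonneg h13]
  refine hasSum_le (fun q => ?_) h11 (h6.add h5)
  rw [h12, hv, norm_mul, mul_pow, Complex.norm_real, Real.norm_eq_abs, sq_abs]
  refine (mul_le_mul_of_nonneg_right (exp_neg_taylor (l q.1) (m q.2)).2 (sq_nonneg _)).trans_eq ?_
  ring

end

/-! ### Differentiability of the free energy -/

section

variable {E : Type*} [NormedAddCommGroup E] [InnerProductSpace ℂ E] [CompleteSpace E]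
  {ι κ : Type*}

namespace Hamiltonian

variable (H : Hamiltonian E)

lemma norm_apply_basis_le {X : omegaDirections H.op} (hX : ‖X‖ < 1) {e : HilbertBasis ι ℂ E}
    {l : ι → ℝ} (h : IsDiagonalized (perturb H.op X.1) e l) (W : omegaDirections H.op) (i : ι) :
    ‖W.1 ⟨e i, h.mem i⟩‖ ≤ ‖W‖ / (1 - ‖X‖) * l i := by
  have h1 := H.norm_op_basis_le X h i
  have h2 := H.norm_apply_le W ⟨e i, h.mem i⟩
  have h3 : 0 < 1 - ‖X‖ := sub_pos.2 hX
  rw [div_mul_eq_mul_div, le_div_iff₀ h3]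
  have h4 := mul_le_mul_of_nonneg_left h1 (norm_nonneg W)
  have h5 := mul_le_mul_of_nonneg_right h2 h3.le
  linarith

/-- An `ω`-direction of `H` as an `ω`-direction of `H + X`. -/
lemma mem_omegaDirections_perturb {X : omegaDirections H.op} (hX : ‖X‖ < 1)
    (W : omegaDirections H.op) : W.1 ∈ omegaDirections (perturb H.op X.1) := by
  refine ⟨W.2.1, ‖W‖ / (1 - ‖X‖), 0, fun x => ?_⟩
  have h3 : 0 < 1 - ‖X‖ := sub_pos.2 hX
  have key : ∀ x : H.op.domain, ‖W.1 x‖ ≤ ‖W‖ / (1 - ‖X‖) * ‖H.op x + X.1 x‖ := fun x => by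
    have h1 := H.norm_apply_le W x
    have h2 := H.norm_apply_le X x
    have h4 : ‖H.op x‖ ≤ ‖H.op x + X.1 x‖ + ‖X.1 x‖ := by
      simpa using norm_sub_le (H.op x + X.1 x) (X.1 x)
    rw [div_mul_eq_mul_div, le_div_iff₀ h3]
    have h5 : (1 - ‖X‖) * ‖H.op x‖ ≤ ‖H.op x + X.1 x‖ := by linarith
    have h6 := mul_le_mul_of_nonneg_left h5 (norm_nonneg W)
    have h7 := mul_le_mul_of_nonneg_right h1 h3.le
    linarith
  rw [zero_mul, add_zero]
  exact key x

lemma inner_basis_perturb {X W : omegaDirections H.op} {e : HilbertBasis ι ℂ E}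
    {f : HilbertBasis κ ℂ E} {l : ι → ℝ} {m : κ → ℝ}
    (h : IsDiagonalized (perturb H.op X.1) e l)
    (h' : IsDiagonalized (perturb H.op (X + W).1) f m) (i : ι) (j : κ) :
    inner ℂ (f j) (W.1 ⟨e i, h.mem i⟩) = ((m j - l i : ℝ) : ℂ) * inner ℂ (f j) (e i) := by
  have h1 : W.1 ⟨e i, h.mem i⟩ =
      perturb H.op (X + W).1 ⟨e i, h.mem i⟩ - perturb H.op X.1 ⟨e i, h.mem i⟩ := by
    change _ = (H.op ⟨e i, h.mem i⟩ + (X.1 ⟨e i, h.mem i⟩ + W.1 ⟨e i, h.mem i⟩)) -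
      (H.op ⟨e i, h.mem i⟩ + X.1 ⟨e i, h.mem i⟩)
    abel
  rw [h1, inner_sub_right, h.apply, inner_smul_right, Complex.ofReal_sub, sub_mul]
  exact congrArg (· - _) (h'.inner_apply j ⟨e i, h.mem i⟩)

/-- On the ball of radius $r$ the single exponent $s=\beta/(1-r)<1$ serves both $X$ and $X+W$, and
both traces at $s$ are at most $\sum_je^{-\beta k_j}$. This makes the constant uniform in $X$, $W$
and the eigenbases. -/
lemma abs_partition_sub_le {g : HilbertBasis κ ℂ E} {k : κ → ℝ}
    (hg : IsDiagonalized H.op g k) (hc : IsCompactOperator H.R) {β : ℝ} (hβ : 0 < β)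
    (hs : Summable fun i => Real.exp (-(β * k i))) {r : ℝ} (hr : r < 1 - β) :
    ∃ C : ℝ, ∀ X W : omegaDirections H.op, ‖X‖ ≤ r → ‖X + W‖ ≤ r →
      ∀ (e : HilbertBasis ι ℂ E) (l : ι → ℝ) (h : IsDiagonalized (perturb H.op X.1) e l),
      |partition (perturb H.op (X + W).1) - partition (perturb H.op X.1) +
        ∑' i, Real.exp (-l i) * (inner ℂ (e i) (W.1 ⟨e i, h.mem i⟩)).re| ≤ C * ‖W‖ ^ 2 := by
  have hr1 : 0 < 1 - r := by linarith
  set s := β / (1 - r) with hs_def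
  have hs1 : s < 1 := by
    rw [hs_def, div_lt_one hr1]
    linarith
  have hs0 : 0 < s := div_pos hβ hr1
  obtain ⟨K, hK0, hK⟩ := exists_rpow_le_exp (c := 2) zero_le_two (sub_pos.2 hs1)
  set S := ∑' j, Real.exp (-(β * k j)) with hS
  have hsβ : ∀ V : omegaDirections H.op, ‖V‖ ≤ r → β ≤ s * (1 - ‖V‖) := fun V hV => by
    have h1 : β = s * (1 - r) := by
      rw [hs_def, div_mul_cancel₀ _ hr1.ne']
    rw [h1]
    exact mul_le_mul_of_nonneg_left (by linarith) hs0.le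
  refine ⟨2 * (K * S / (1 - r) ^ 2), fun X W hX hXW e l h => ?_⟩
  obtain ⟨ι', f, m, h'⟩ := H.exists_isDiagonalized_perturb hc (X + W) (by linarith)
  obtain ⟨hl, hlS⟩ := H.summable_exp_perturb hg hβ.le hs X h hs0.le (hsβ X hX)
  obtain ⟨hm, hmS⟩ := H.summable_exp_perturb hg hβ.le hs (X + W) h' hs0.le (hsβ _ hXW)
  have hl1 : Summable fun i => Real.exp (-l i) := by
    simpa using h.summable_rpow_mul_exp hs1 hl le_rfl
  have hm1 : Summable fun i => Real.exp (-m i) := by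
    simpa using h'.summable_rpow_mul_exp hs1 hm le_rfl
  have hW : ∀ {V : omegaDirections H.op}, ‖V‖ ≤ r → ‖W‖ / (1 - ‖V‖) ≤ ‖W‖ / (1 - r) :=
    fun hV => div_le_div_of_nonneg_left (norm_nonneg W) hr1 (by linarith)
  obtain ⟨hv, hv'⟩ := summable_diag_and_le (fun i => (h.pos i).le) hK hl
    (v := fun i => W.1 ⟨e i, h.mem i⟩) fun i =>
      (H.norm_apply_basis_le (by linarith) h W i).trans
        (mul_le_mul_of_nonneg_right (hW hX) (h.pos i).le)
  obtain ⟨hw, hw'⟩ := summable_diag_and_le (fun i => (h'.pos i).le) hK hm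
    (v := fun i => W.1 ⟨f i, h'.mem i⟩) fun i =>
      (H.norm_apply_basis_le (by linarith) h' W i).trans
        (mul_le_mul_of_nonneg_right (hW hXW) (h'.pos i).le)
  have h1 := abs_sum_exp_sub_le (fun i j => (W.2.1 ⟨f j, h'.mem j⟩ ⟨e i, h.mem i⟩).symm)
    (H.inner_basis_perturb h h') hl1 hm1 hv hw
  rw [h.partition_eq hl1, h'.partition_eq hm1]
  refine h1.trans ?_
  have h2 : 0 ≤ (‖W‖ / (1 - r)) ^ 2 * K := by positivity
  have h3 := hv'.trans (mul_le_mul_of_nonneg_left hlS h2)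
  have h4 := hw'.trans (mul_le_mul_of_nonneg_left hmS h2)
  refine (add_le_add h4 h3).trans_eq ?_
  rw [div_pow]
  ring

lemma exists_hasFDerivAt_freeEnergy [Nontrivial E] {g : HilbertBasis κ ℂ E} {k : κ → ℝ}
    (hg : IsDiagonalized H.op g k) (hc : IsCompactOperator H.R) {β : ℝ} (hβ : 0 < β)
    (hs : Summable fun i => Real.exp (-(β * k i))) {X : omegaDirections H.op}
    (hX : ‖X‖ < 1 - β) {e : HilbertBasis ι ℂ E} {l : ι → ℝ}
    (h : IsDiagonalized (perturb H.op X.1) e l) {s : ℝ} (hs1 : s < 1)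
    (hsum : Summable fun i => Real.exp (-(s * l i))) :
    ∃ L : omegaDirections H.op →L[ℝ] ℝ,
      HasFDerivAt (fun V : omegaDirections H.op => freeEnergy (perturb H.op V.1)) L X ∧
      ∀ Y : omegaDirections H.op, (L Y : ℂ) = -mean (state (perturb H.op X.1)) (toOp Y) := by
  have hX1 : ‖X‖ < 1 := by linarith
  have hl : Summable fun i => Real.exp (-l i) := by
    simpa using h.summable_rpow_mul_exp hs1 hsum le_rfl
  have hl1 : Summable fun i => l i * Real.exp (-l i) := by
    simpa using h.summable_rpow_mul_exp hs1 hsum zero_le_one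
  have hZ := h.partition_pos hl
  have hbd : ∀ (W : omegaDirections H.op) i,
      ‖Real.exp (-l i) * (inner ℂ (e i) (W.1 ⟨e i, h.mem i⟩)).re‖ ≤
      ‖W‖ / (1 - ‖X‖) * (l i * Real.exp (-l i)) := fun W i => by
    have h1 := (Complex.abs_re_le_norm _).trans
      (norm_inner_le_norm (𝕜 := ℂ) (e i) (W.1 ⟨e i, h.mem i⟩))
    rw [norm_hilbertBasis, one_mul] at h1
    rw [norm_mul, Real.norm_eq_abs, Real.norm_eq_abs, abs_of_pos (Real.exp_pos _), ← mul_assoc,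
      mul_comm]
    exact mul_le_mul_of_nonneg_right (h1.trans (H.norm_apply_basis_le hX1 h W i))
      (Real.exp_nonneg _)
  have hsm : ∀ W : omegaDirections H.op,
      Summable fun i => Real.exp (-l i) * (inner ℂ (e i) (W.1 ⟨e i, h.mem i⟩)).re := fun W =>
    Summable.of_norm_bounded (hl1.mul_left _) (hbd W)
  let D₀ : omegaDirections H.op →ₗ[ℝ] ℝ :=
    { toFun := fun W => ∑' i, Real.exp (-l i) * (inner ℂ (e i) (W.1 ⟨e i, h.mem i⟩)).re
      map_add' := fun W W' => by
        rw [← (hsm W).tsum_add (hsm W')]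
        refine tsum_congr fun i => ?_
        rw [← mul_add, ← Complex.add_re, ← inner_add_right]
        rfl
      map_smul' := fun t W => by
        rw [RingHom.id_apply, smul_eq_mul, ← tsum_mul_left]
        refine tsum_congr fun i => ?_
        have h1 : (t • W).1 ⟨e i, h.mem i⟩ = (t : ℂ) • W.1 ⟨e i, h.mem i⟩ := by
          rw [Complex.coe_smul]
          rfl
        rw [h1, inner_smul_right, Complex.re_ofReal_mul]
        ring }
  let D : omegaDirections H.op →L[ℝ] ℝ :=
    D₀.mkContinuous ((1 - ‖X‖)⁻¹ * ∑' i, l i * Real.exp (-l i)) fun W => by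
      refine (tsum_of_norm_bounded (hl1.hasSum.mul_left _) (hbd W)).trans_eq ?_
      rw [div_eq_mul_inv]
      ring
  have hD : ∀ W, D W = ∑' i, Real.exp (-l i) * (inner ℂ (e i) (W.1 ⟨e i, h.mem i⟩)).re :=
    fun W => rfl
  have hF : HasFDerivAt (fun V : omegaDirections H.op => partition (perturb H.op V.1)) (-D) X := by
    rw [hasFDerivAt_iff_isLittleO_nhds_zero]
    -- Any radius strictly between $\|X\|$ and $1-\beta$ works: the first inequality leaves room for
    -- small $W$, the second is required by the remainder bound.
    set r := (‖X‖ + (1 - β)) / 2 with hr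
    have hXr : ‖X‖ < r := by rw [hr]; linarith
    obtain ⟨C, hC⟩ := H.abs_partition_sub_le (ι := ι) hg hc hβ hs (r := r) (by rw [hr]; linarith)
    refine Asymptotics.IsBigO.trans_isLittleO ?_ (Asymptotics.isLittleO_norm_pow_id one_lt_two)
    refine Asymptotics.IsBigO.of_bound C ?_
    filter_upwards [Metric.ball_mem_nhds (0 : omegaDirections H.op) (sub_pos.2 hXr)] with W hW
    rw [mem_ball_zero_iff] at hW
    have h1 := hC X W hXr.le ((norm_add_le X W).trans (by linarith)) e l h
    rw [neg_apply, sub_neg_eq_add, hD, Real.norm_eq_abs, norm_pow, norm_norm]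
    exact h1
  refine ⟨_, hF.log hZ.ne', fun Y => ?_⟩
  have h2 := h.hasSum_mean hs1 hsum ⟨Y.1, H.mem_omegaDirections_perturb hX1 Y⟩
  have h3 : mean (state (perturb H.op X.1)) (toOp Y) =
      (((partition (perturb H.op X.1))⁻¹ * D Y : ℝ) : ℂ) := by
    refine HasSum.unique h2 ?_
    have h4 := Complex.hasSum_ofReal.2 ((hsm Y).hasSum.mul_left (partition (perturb H.op X.1))⁻¹)
    refine h4.congr_fun fun i => ?_
    -- Symmetry of $Y$ makes its diagonal elements real, so the real derivative equals the
    -- complex-valued mean.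
    have h5 : ((inner ℂ (e i) (Y.1 ⟨e i, h.mem i⟩)).re : ℂ) =
        inner ℂ (e i) (Y.1 ⟨e i, h.mem i⟩) := by
      refine Complex.conj_eq_iff_re.1 ?_
      rw [inner_conj_symm]
      exact Y.2.1 ⟨e i, h.mem i⟩ ⟨e i, h.mem i⟩
    refine (congrArg (fun z : ℂ => (((partition (perturb H.op X.1))⁻¹ * Real.exp (-l i) : ℝ) : ℂ) * z)
      h5.symm).trans ?_
    push_cast
    ring
  rw [h3, smul_apply, neg_apply, smul_eq_mul, mul_neg, Complex.ofReal_neg]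

end Hamiltonian

end

end BKM

theorem mainTheorem3 {E : Type*} [NormedAddCommGroup E] [InnerProductSpace ℂ E] [CompleteSpace E]
    [Nontrivial E] (H₀ : BKM.Hamiltonian E) (β₀ : ℝ) (hβ₀ : 0 < β₀) (hβ₁ : β₀ < 1)
    (hH₀ : BKM.IsSchatten β₀ (BKM.expNeg H₀.op))
    (X : BKM.omegaDirections H₀.op) (hX : ‖X‖ < 1 - β₀)
    (H_X : E →ₗ.[ℂ] E) (hH_X : H_X = BKM.perturb H₀.op X.1)
    (ρ_X : E →L[ℂ] E) (hρ_X : ρ_X = BKM.state H_X) :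
    -- the state `ρ_X` and its free energy make sense
    (BKM.IsTraceClass (BKM.expNeg H_X) ∧ 0 < BKM.partition H_X) ∧
    -- the BKM metric is finite on `ω`-directions
    (∀ Y Z : BKM.omegaDirections H_X, BKM.BKMFinite ρ_X (BKM.toOp Y) (BKM.toOp Z)) ∧
    -- the mean `ρ_X.Y` makes sense for every `ω`-direction
    (∀ Y : BKM.omegaDirections H_X,
      BKM.HasTraceClassExt (BKM.stateMul ρ_X (BKM.toOp Y))) ∧
    -- the free energy is Fréchet differentiable at `X`, with derivative `Y ↦ -ρ_X.Y`
    (∃ L : BKM.omegaDirections H₀.op →L[ℝ] ℝ,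
      HasFDerivAt (fun V : BKM.omegaDirections H₀.op =>
        BKM.freeEnergy (BKM.perturb H₀.op V.1)) L X ∧
      ∀ Y : BKM.omegaDirections H₀.op, (L Y : ℂ) = -BKM.mean ρ_X (BKM.toOp Y)) ∧
    -- `|ρ_X.Y| ≤ C ‖R_X Y‖`
    (∀ c m : ℝ, 0 < m → BKM.LowerBound m (BKM.addConst H_X c) →
      ∃ C : ℝ, ∀ Y : BKM.omegaDirections H_X,
        ‖BKM.mean ρ_X (BKM.toOp Y)‖ ≤
          C * BKM.omegaSize (BKM.bddInv (BKM.addConst H_X c)) (BKM.toOp Y)) := by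
  subst hH_X hρ_X
  obtain ⟨κ, g, k, hg, hs, hc⟩ := H₀.exists_isDiagonalized hβ₀ hH₀
  have hX1 : ‖X‖ < 1 := by linarith
  obtain ⟨ι, e, l, h⟩ := H₀.exists_isDiagonalized_perturb hc X hX1
  have hX2 : 0 < 1 - ‖X‖ := sub_pos.2 hX1
  -- This is exactly the hypothesis $\|X\|_\omega<1-\beta_0$, and the only place where the trace
  -- bound for $H_X$ needs it in full strength.
  have hs1 : β₀ / (1 - ‖X‖) < 1 := by
    rw [div_lt_one hX2]
    linarith
  have hsum := (H₀.summable_exp_perturb hg hβ₀.le hs X h (div_pos hβ₀ hX2).le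
    (div_mul_cancel₀ β₀ hX2.ne').ge).1
  have hl : Summable fun i => Real.exp (-l i) := by
    simpa using h.summable_rpow_mul_exp hs1 hsum le_rfl
  exact ⟨⟨h.isTraceClass_expNeg hl, h.partition_pos hl⟩, h.bkmFinite hs1 hsum,
    h.hasTraceClassExt_stateMul hs1 hsum,
    H₀.exists_hasFDerivAt_freeEnergy hg hc hβ₀ hs hX h hs1 hsum,
    fun _ _ hm0 hm => h.exists_norm_mean_le hs1 hsum hm0 hm⟩
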